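/- **Theorem (Mountain pass characterization of the second eigenvalue).** Let $N\ge 1$, $1<p<\infty$, $0<s<1$, and let $\Omega\subset\mathbb{R}^N$ be an open and bounded set. Let $\widetilde W^{s,p}_0(\Omega)$ be the completion of $C_0^\infty(\Omega)$ with respect to the norm $$\|u\|_{\widetilde W^{s,p}_0(\Omega)}=\left(\int_{\mathbb{R}^N}\int_{\mathbb{R}^N}\frac{|u(x)-u(y)|^p}{|x-y|^{N+sp}}\,dx\,dy\right)^{1/p}$$ (regarded as a space of functions in $L^p(\mathbb{R}^N)$), and let $$\mathcal{S}_p(\Omega)=\left\{u\in\widetilde W^{s,p}_0(\Omega):\int_\Omega|u|^p\,dx=1\right\},$$ with the topology induced by this norm. Define $$\lambda_2(\Omega)=\inf_{f\in\mathcal{C}_1(\Omega)}\ \max_{u\in \mathrm{Im}(f)}\|u\|^p_{\widetilde W^{s,p}_0(\Omega)},\qquad \mathcal{C}_1(\Omega)=\{f:\mathbb{S}^1\to\mathcal{S}_p(\Omega)\ :\ f\text{ odd and continuous}\}.$$ Let $u_1\in\mathcal{S}_p(\Omega)$ be a first eigenfunction, that is, a minimizer of $\|\cdot\|^p_{\widetilde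 W^{s,p}_0(\Omega)}$ on $\mathcal{S}_p(\Omega)$, and let $$\Gamma(u_1,-u_1)=\{\gamma\in C^0([0,1];\mathcal{S}_p(\Omega)):\gamma_0=u_1,\ \gamma_1=-u_1\}.$$ Then $\Gamma(u_1,-u_1)$ is not empty and $$\lambda_2(\Omega)=\inf_{\gamma\in\Gamma(u_1,-u_1)}\ \max_{u\in\mathrm{Im}(\gamma)}\|u\|^p_{\widetilde W^{s,p}_0(\Omega)}.$$ -/

import Mathlib

open MeasureTheory Set Filter Topology
open scoped ENNReal

noncomputable section

namespace FracPLaplace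

/-- The space `ℝ^N` with its Euclidean norm. -/
abbrev Eucl (N : ℕ) : Type := EuclideanSpace ℝ (Fin N)

/-! ### The Gagliardo energy -/

/-- `∬ |u(x) - u(y)|^p / |x - y|^(N + s p) dx dy` over `ℝ^N × ℝ^N`, with values in `[0, ∞]`. -/
def gagliardoEnergy {N : ℕ} (s p : ℝ) (u : Eucl N → ℝ) : ℝ≥0∞ :=
  ∫⁻ z : Eucl N × Eucl N,
    ENNReal.ofReal (|u z.1 - u z.2| ^ p / ‖z.1 - z.2‖ ^ ((N : ℝ) + s * p))

/-- The Gagliardo seminorm, the `p`-th root of the energy. -/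
def gagliardoSeminorm {N : ℕ} (s p : ℝ) (u : Eucl N → ℝ) : ℝ≥0∞ :=
  gagliardoEnergy s p u ^ (1 / p)

/-- The measure `|x - y|^(-(N + s p)) dx dy` on `ℝ^N × ℝ^N`; the Gagliardo seminorm is the
`L^p` norm of `(x, y) ↦ u(x) - u(y)` for it, see `gagliardoSeminorm_eq_eLpNorm`. -/
def gagliardoMeasure (N : ℕ) (s p : ℝ) : Measure (Eucl N × Eucl N) :=
  (volume : Measure (Eucl N × Eucl N)).withDensity
    (fun z => ENNReal.ofReal ((‖z.1 - z.2‖ ^ ((N : ℝ) + s * p))⁻¹))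

theorem gagliardoSeminorm_eq_eLpNorm {N : ℕ} (s : ℝ) {p : ℝ} (hp : 1 < p) (u : Eucl N → ℝ) :
    gagliardoSeminorm s p u =
      eLpNorm (fun z : Eucl N × Eucl N => u z.1 - u z.2) (ENNReal.ofReal p)
        (gagliardoMeasure N s p) := by
  have hp0 : 0 < p := by linarith
  rw [eLpNorm_eq_lintegral_rpow_enorm_toReal (by simpa using hp0) ENNReal.ofReal_ne_top,
    ENNReal.toReal_ofReal hp0.le, gagliardoSeminorm, gagliardoEnergy, gagliardoMeasure,
    lintegral_withDensity_eq_lintegral_mul_non_measurable]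
  · congr 1
    refine lintegral_congr fun z => ?_
    have h1 : (0 : ℝ) ≤ |u z.1 - u z.2| ^ p := by positivity
    rw [Pi.mul_apply, div_eq_mul_inv, ENNReal.ofReal_mul h1, mul_comm,
      ← ENNReal.ofReal_rpow_of_nonneg (abs_nonneg _) hp0.le, ← Real.norm_eq_abs,
      ofReal_norm]
  · fun_prop
  · exact Filter.Eventually.of_forall fun z => ENNReal.ofReal_lt_top

theorem gagliardoMeasure_absolutelyContinuous (N : ℕ) (s p : ℝ) :
    gagliardoMeasure N s p ≪ (volume : Measure (Eucl N × Eucl N)) :=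
  withDensity_absolutelyContinuous _ _

theorem aestronglyMeasurable_diff {N : ℕ} {u : Eucl N → ℝ}
    (hu : AEStronglyMeasurable u (volume : Measure (Eucl N))) :
    AEStronglyMeasurable (fun z : Eucl N × Eucl N => u z.1 - u z.2)
      (volume : Measure (Eucl N × Eucl N)) :=
  (hu.comp_quasiMeasurePreserving Measure.quasiMeasurePreserving_fst).sub
    (hu.comp_quasiMeasurePreserving Measure.quasiMeasurePreserving_snd)

theorem gagliardoSeminorm_congr {N : ℕ} (s : ℝ) {p : ℝ} {u v : Eucl N → ℝ}
    (h : u =ᵐ[volume] v) : gagliardoSeminorm s p u = gagliardoSeminorm s p v := by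
  have h1 := Measure.quasiMeasurePreserving_fst (μ := (volume : Measure (Eucl N)))
    (ν := (volume : Measure (Eucl N))) |>.ae_eq_comp h
  have h2 := Measure.quasiMeasurePreserving_snd (μ := (volume : Measure (Eucl N)))
    (ν := (volume : Measure (Eucl N))) |>.ae_eq_comp h
  unfold gagliardoSeminorm gagliardoEnergy
  congr 1
  refine lintegral_congr_ae ?_
  filter_upwards [h1, h2] with z hz1 hz2
  simp only [Function.comp_apply] at hz1 hz2
  rw [hz1, hz2]

theorem gagliardoSeminorm_add_le {N : ℕ} (s : ℝ) {p : ℝ} (hp : 1 < p) {u v : Eucl N → ℝ}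
    (hu : AEStronglyMeasurable u (volume : Measure (Eucl N)))
    (hv : AEStronglyMeasurable v (volume : Measure (Eucl N))) :
    gagliardoSeminorm s p (u + v) ≤ gagliardoSeminorm s p u + gagliardoSeminorm s p v := by
  simp only [gagliardoSeminorm_eq_eLpNorm s hp]
  have hac := gagliardoMeasure_absolutelyContinuous N s p
  refine le_trans (le_of_eq ?_) (eLpNorm_add_le ((aestronglyMeasurable_diff hu).mono_ac hac)
    ((aestronglyMeasurable_diff hv).mono_ac hac) ?_)
  · congr 1
    ext z
    simp only [Pi.add_apply]
    ring
  · simpa using hp.le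

theorem gagliardoSeminorm_smul {N : ℕ} (s : ℝ) {p : ℝ} (hp : 1 < p) (c : ℝ) (u : Eucl N → ℝ) :
    gagliardoSeminorm s p (c • u) = ‖c‖ₑ * gagliardoSeminorm s p u := by
  simp only [gagliardoSeminorm_eq_eLpNorm s hp]
  rw [← eLpNorm_const_smul]
  congr 1
  ext z
  simp only [Pi.smul_apply, smul_eq_mul]
  ring

/-! ### The Sobolev space -/

/-- `φ ∈ C₀^∞(Ω)`: smooth with compact support contained in `Ω`. -/
def IsTestFunction {N : ℕ} (Ω : Set (Eucl N)) (φ : Eucl N → ℝ) : Prop :=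
  ContDiff ℝ (⊤ : ℕ∞) φ ∧ HasCompactSupport φ ∧ tsupport φ ⊆ Ω

theorem IsTestFunction.aestronglyMeasurable {N : ℕ} {Ω : Set (Eucl N)} {φ : Eucl N → ℝ}
    (h : IsTestFunction Ω φ) : AEStronglyMeasurable φ (volume : Measure (Eucl N)) :=
  h.1.continuous.aestronglyMeasurable

/-- The completion of `C₀^∞(Ω)`, realized inside `L^p(ℝ^N)`: the (classes of) functions of finite
Gagliardo seminorm that are limits of test functions in the `L^p` norm and in the Gagliardo
seminorm. -/
def sobolevSubmodule {N : ℕ} (Ω : Set (Eucl N)) (s p : ℝ) [hp : Fact (1 < p)] :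
    Submodule ℝ (Lp ℝ (ENNReal.ofReal p) (volume : Measure (Eucl N))) where
  carrier := {u | gagliardoSeminorm s p u < ∞ ∧
    ∃ φ : ℕ → Eucl N → ℝ, (∀ n, IsTestFunction Ω (φ n)) ∧
      Tendsto (fun n => eLpNorm (⇑u - φ n) (ENNReal.ofReal p) volume) atTop (𝓝 0) ∧
      Tendsto (fun n => gagliardoSeminorm s p (⇑u - φ n)) atTop (𝓝 0)}
  zero_mem' := by
    have h0 : gagliardoSeminorm s p (0 : Eucl N → ℝ) = 0 := by
      simpa using gagliardoSeminorm_smul s hp.out 0 (0 : Eucl N → ℝ)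
    have hz := Lp.coeFn_zero ℝ (ENNReal.ofReal p) (volume : Measure (Eucl N))
    refine ⟨?_, fun _ => 0, fun _ => ⟨contDiff_const, HasCompactSupport.zero, ?_⟩, ?_, ?_⟩
    · rw [gagliardoSeminorm_congr s hz, h0]
      exact ENNReal.zero_lt_top
    · have : tsupport (0 : Eucl N → ℝ) = ∅ := by simp [tsupport]
      rw [this]
      exact empty_subset _
    · have : eLpNorm (⇑(0 : Lp ℝ (ENNReal.ofReal p) (volume : Measure (Eucl N))) - 0)
          (ENNReal.ofReal p) volume = 0 := by
        rw [sub_zero, eLpNorm_congr_ae hz, eLpNorm_zero]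
      simp only [this]
      exact tendsto_const_nhds
    · have : gagliardoSeminorm s p
          (⇑(0 : Lp ℝ (ENNReal.ofReal p) (volume : Measure (Eucl N))) - 0) = 0 := by
        rw [sub_zero, gagliardoSeminorm_congr s hz, h0]
      simp only [this]
      exact tendsto_const_nhds
  add_mem' := by
    rintro u v ⟨hu, φ, hφ, hφ1, hφ2⟩ ⟨hv, ψ, hψ, hψ1, hψ2⟩
    have hadd := Lp.coeFn_add u v
    have hum := (Lp.aestronglyMeasurable u)
    have hvm := (Lp.aestronglyMeasurable v)
    have hdiff : ∀ n, (⇑(u + v) - (φ n + ψ n) : Eucl N → ℝ) =ᵐ[volume]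
        (⇑u - φ n) + (⇑v - ψ n) := by
      intro n
      filter_upwards [hadd] with x hx
      simp only [Pi.sub_apply, Pi.add_apply, hx]
      ring
    refine ⟨?_, fun n => φ n + ψ n, fun n => ⟨(hφ n).1.add (hψ n).1,
      (hφ n).2.1.add (hψ n).2.1, ?_⟩, ?_, ?_⟩
    · rw [gagliardoSeminorm_congr s hadd]
      exact (gagliardoSeminorm_add_le s hp.out hum hvm).trans_lt (ENNReal.add_lt_top.2 ⟨hu, hv⟩)
    · exact (tsupport_add (φ n) (ψ n)).trans (union_subset (hφ n).2.2 (hψ n).2.2)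
    · refine tendsto_of_tendsto_of_tendsto_of_le_of_le tendsto_const_nhds
        (by simpa using hφ1.add hψ1) (fun _ => zero_le) (fun n => ?_)
      rw [eLpNorm_congr_ae (hdiff n)]
      exact eLpNorm_add_le (hum.sub (hφ n).aestronglyMeasurable)
        (hvm.sub (hψ n).aestronglyMeasurable) (by simpa using hp.out.le)
    · refine tendsto_of_tendsto_of_tendsto_of_le_of_le tendsto_const_nhds
        (by simpa using hφ2.add hψ2) (fun _ => zero_le) (fun n => ?_)
      rw [gagliardoSeminorm_congr s (hdiff n)]
      exact gagliardoSeminorm_add_le s hp.out (hum.sub (hφ n).aestronglyMeasurable)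
        (hvm.sub (hψ n).aestronglyMeasurable)
  smul_mem' := by
    rintro c u ⟨hu, φ, hφ, hφ1, hφ2⟩
    have hsmul := Lp.coeFn_smul c u
    have hdiff : ∀ n, (⇑(c • u) - c • φ n : Eucl N → ℝ) =ᵐ[volume] c • (⇑u - φ n) := by
      intro n
      filter_upwards [hsmul] with x hx
      simp only [Pi.sub_apply, Pi.smul_apply, hx, smul_eq_mul]
      ring
    refine ⟨?_, fun n => c • φ n, fun n => ⟨contDiff_const.smul (hφ n).1,
      (hφ n).2.1.smul_left (f := fun _ => c), ?_⟩, ?_, ?_⟩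
    · rw [gagliardoSeminorm_congr s hsmul, gagliardoSeminorm_smul s hp.out]
      exact ENNReal.mul_lt_top (by simp) hu
    · exact (closure_mono (Function.support_const_smul_subset c (φ n))).trans (hφ n).2.2
    · simp only [eLpNorm_congr_ae (hdiff _), eLpNorm_const_smul]
      simpa using ENNReal.Tendsto.const_mul hφ1 (Or.inr (enorm_ne_top (x := c)))
    · simp only [gagliardoSeminorm_congr s (hdiff _), gagliardoSeminorm_smul s hp.out]
      simpa using ENNReal.Tendsto.const_mul hφ2 (Or.inr (enorm_ne_top (x := c)))

/-- The space of `sobolevSubmodule` as a type of its own: its norm is the Gagliardo seminorm and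
not the `L^p` norm. -/
def SobolevSpace {N : ℕ} (Ω : Set (Eucl N)) (s p : ℝ) [Fact (1 < p)] : Type :=
  ↥(sobolevSubmodule Ω s p)

namespace SobolevSpace

variable {N : ℕ} {Ω : Set (Eucl N)} {s p : ℝ} [hp : Fact (1 < p)]

instance : AddCommGroup (SobolevSpace Ω s p) :=
  inferInstanceAs (AddCommGroup ↥(sobolevSubmodule Ω s p))

instance : Module ℝ (SobolevSpace Ω s p) :=
  inferInstanceAs (Module ℝ ↥(sobolevSubmodule Ω s p))

/-- The underlying class in `L^p(ℝ^N)`. -/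
def toLp (u : SobolevSpace Ω s p) : Lp ℝ (ENNReal.ofReal p) (volume : Measure (Eucl N)) :=
  Subtype.val u

theorem gagliardoSeminorm_ne_top (u : SobolevSpace Ω s p) :
    gagliardoSeminorm s p u.toLp ≠ ∞ :=
  (Subtype.prop u : u.toLp ∈ sobolevSubmodule Ω s p).1.ne

theorem toLp_eq_zero [NeZero N] (u : SobolevSpace Ω s p)
    (h : gagliardoSeminorm s p u.toLp = 0) : u.toLp = 0 := by
  have hp0 : 0 < p := by linarith [hp.out]
  have hm := aestronglyMeasurable_diff (Lp.aestronglyMeasurable u.toLp)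
  have hE : gagliardoEnergy s p u.toLp = 0 := by
    rcases (ENNReal.rpow_eq_zero_iff.1 h) with h | h
    · exact h.1
    · exact absurd h.2 (by simp [hp0.le])
  rw [gagliardoEnergy, lintegral_eq_zero_iff'] at hE
  · have h1 : ∀ᵐ z : Eucl N × Eucl N, u.toLp z.1 = u.toLp z.2 := by
      filter_upwards [hE] with z hz
      simp only [Pi.zero_apply, ENNReal.ofReal_eq_zero] at hz
      by_cases hxy : z.1 = z.2
      · rw [hxy]
      · by_contra hne
        have h2 : 0 < |u.toLp z.1 - u.toLp z.2| := abs_pos.2 (sub_ne_zero.2 hne)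
        have h3 : 0 < ‖z.1 - z.2‖ := norm_pos_iff.2 (sub_ne_zero.2 hxy)
        have h4 : 0 < |u.toLp z.1 - u.toLp z.2| ^ p / ‖z.1 - z.2‖ ^ ((N : ℝ) + s * p) := by
          positivity
        linarith
    have h2 : ∀ᵐ x : Eucl N, ∀ᵐ y : Eucl N, u.toLp x = u.toLp y :=
      Measure.ae_ae_of_ae_prod h1
    obtain ⟨x, hx⟩ := h2.exists
    have hmem : MemLp (fun _ : Eucl N => u.toLp x) (ENNReal.ofReal p) volume := by
      refine (memLp_congr_ae ?_).1 (Lp.memLp u.toLp)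
      filter_upwards [hx] with y hy using hy.symm
    rw [memLp_const_iff (by simpa using hp0) ENNReal.ofReal_ne_top] at hmem
    have : NoncompactSpace (Eucl N) := NormedSpace.noncompactSpace ℝ (Eucl N)
    have hx0 : u.toLp x = 0 := by
      rcases hmem with h | h
      · exact h
      · simp at h
    rw [Lp.eq_zero_iff_ae_eq_zero]
    filter_upwards [hx] with y hy
    simp [← hy, hx0]
  · have := (hm.aemeasurable.abs.pow_const p).div
      ((by fun_prop : Measurable fun z : Eucl N × Eucl N =>
        ‖z.1 - z.2‖ ^ ((N : ℝ) + s * p)).aemeasurable (μ := volume))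
    exact this.ennreal_ofReal

/-- `‖u‖ = (∬ |u(x) - u(y)|^p / |x - y|^(N + s p) dx dy)^(1/p)`. -/
def addGroupNorm [NeZero N] : AddGroupNorm (SobolevSpace Ω s p) where
  toFun u := (gagliardoSeminorm s p u.toLp).toReal
  map_zero' := by
    have h := gagliardoSeminorm_smul s hp.out 0 (0 : Eucl N → ℝ)
    have hz := Lp.coeFn_zero ℝ (ENNReal.ofReal p) (volume : Measure (Eucl N))
    change (gagliardoSeminorm s p
      (⇑(0 : Lp ℝ (ENNReal.ofReal p) (volume : Measure (Eucl N))))).toReal = 0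
    rw [gagliardoSeminorm_congr s hz]
    simp only [zero_smul, enorm_zero, zero_mul] at h
    rw [h, ENNReal.toReal_zero]
  add_le' u v := by
    rw [← ENNReal.toReal_add u.gagliardoSeminorm_ne_top v.gagliardoSeminorm_ne_top]
    refine ENNReal.toReal_mono
      (ENNReal.add_ne_top.2 ⟨u.gagliardoSeminorm_ne_top, v.gagliardoSeminorm_ne_top⟩) ?_
    rw [gagliardoSeminorm_congr s (show ⇑(u + v).toLp =ᵐ[volume] _ from
      Lp.coeFn_add u.toLp v.toLp)]
    exact gagliardoSeminorm_add_le s hp.out (Lp.aestronglyMeasurable _)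
      (Lp.aestronglyMeasurable _)
  neg' u := by
    rw [gagliardoSeminorm_congr s (show ⇑(-u).toLp =ᵐ[volume] _ from Lp.coeFn_neg u.toLp),
      ← neg_one_smul ℝ (⇑u.toLp), gagliardoSeminorm_smul s hp.out]
    simp
  eq_zero_of_map_eq_zero' u h := by
    rcases (ENNReal.toReal_eq_zero_iff _).1 h with h | h
    · exact Subtype.ext (u.toLp_eq_zero h)
    · exact absurd h u.gagliardoSeminorm_ne_top

instance [NeZero N] : NormedAddCommGroup (SobolevSpace Ω s p) :=
  addGroupNorm.toNormedAddCommGroup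

theorem norm_def [NeZero N] (u : SobolevSpace Ω s p) :
    ‖u‖ = (gagliardoSeminorm s p u.toLp).toReal :=
  rfl

theorem norm_rpow [NeZero N] (u : SobolevSpace Ω s p) :
    ‖u‖ ^ p = (gagliardoEnergy s p u.toLp).toReal := by
  have hp0 : p ≠ 0 := by linarith [hp.out]
  rw [norm_def, gagliardoSeminorm, ENNReal.toReal_rpow, ← ENNReal.rpow_mul,
    one_div_mul_cancel hp0, ENNReal.rpow_one]

instance [NeZero N] : NormedSpace ℝ (SobolevSpace Ω s p) where
  norm_smul_le c u := by
    rw [norm_def, norm_def, gagliardoSeminorm_congr s (show ⇑(c • u).toLp =ᵐ[volume] _ from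
      Lp.coeFn_smul c u.toLp), gagliardoSeminorm_smul s hp.out, ENNReal.toReal_mul]
    simp

end SobolevSpace

/-! ### The sphere, the first eigenfunctions and the second eigenvalue -/

/-- `S_p(Ω)`: the elements of the Sobolev space with `∫_Ω |u|^p = 1`. -/
def unitLpSphere {N : ℕ} (Ω : Set (Eucl N)) (s p : ℝ) [Fact (1 < p)] :
    Set (SobolevSpace Ω s p) :=
  {u | ∫ x in Ω, |u.toLp x| ^ p = 1}

/-- A (normalized) first eigenfunction: a minimizer of `‖·‖^p` on `S_p(Ω)`. -/
def IsFirstEigenfunction {N : ℕ} [NeZero N] {Ω : Set (Eucl N)} {s p : ℝ} [Fact (1 < p)]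
    (u : SobolevSpace Ω s p) : Prop :=
  u ∈ unitLpSphere Ω s p ∧ IsMinOn (fun v : SobolevSpace Ω s p => ‖v‖ ^ p) (unitLpSphere Ω s p) u

/-- `M = max_{u ∈ Im f} ‖u‖^p`. -/
def IsMaxEnergy {N : ℕ} [NeZero N] {Ω : Set (Eucl N)} {s p : ℝ} [Fact (1 < p)]
    {X : Type*} [TopologicalSpace X] (f : C(X, SobolevSpace Ω s p)) (M : ℝ) : Prop :=
  IsGreatest ((fun u : SobolevSpace Ω s p => ‖u‖ ^ p) '' range f) M

/-- On a nonempty compact parameter space the maximum of the energy always exists. -/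
theorem exists_isMaxEnergy {N : ℕ} [NeZero N] {Ω : Set (Eucl N)} {s p : ℝ} [hp : Fact (1 < p)]
    {X : Type*} [TopologicalSpace X] [CompactSpace X] [Nonempty X]
    (f : C(X, SobolevSpace Ω s p)) : ∃ M, IsMaxEnergy f M := by
  have hp0 : 0 ≤ p := by linarith [hp.out]
  exact ((isCompact_range f.continuous).image
    (continuous_norm.rpow_const fun _ => Or.inr hp0)).exists_isGreatest
    ((range_nonempty f).image _)

/-- The unit circle in `ℝ²`. -/
abbrev UnitCircle : Type := Metric.sphere (0 : EuclideanSpace ℝ (Fin 2)) 1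

/-- The odd continuous maps from the unit circle to `S_p(Ω)`. -/
def oddMaps {N : ℕ} [NeZero N] (Ω : Set (Eucl N)) (s p : ℝ) [Fact (1 < p)] :
    Set C(UnitCircle, SobolevSpace Ω s p) :=
  {f | (∀ ω, f ω ∈ unitLpSphere Ω s p) ∧ ∀ ω, f (-ω) = -f ω}

/-- The second eigenvalue `λ₂(Ω)`: the infimum, over odd continuous maps `f` from the unit circle
to `S_p(Ω)`, of the maximum of the energy on the image of `f`. -/
def secondEigenvalue {N : ℕ} [NeZero N] (Ω : Set (Eucl N)) (s p : ℝ) [Fact (1 < p)] : ℝ :=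
  sInf {M | ∃ f ∈ oddMaps Ω s p, IsMaxEnergy f M}

/-- `Γ(u, v)`: the continuous curves on `S_p(Ω)` from `u` to `v`. -/
def pathsOnSphere {N : ℕ} [NeZero N] {Ω : Set (Eucl N)} {s p : ℝ} [Fact (1 < p)]
    (u v : SobolevSpace Ω s p) : Set C(unitInterval, SobolevSpace Ω s p) :=
  {γ | (∀ t, γ t ∈ unitLpSphere Ω s p) ∧ γ 0 = u ∧ γ 1 = v}

end FracPLaplace

end

noncomputable section

namespace FracPLaplace

/-! ### Dominated convergence in `L^q` -/

/-! Both infima are read off from the sublevel sets of the energy `‖u‖ ^ p` on the sphere, which are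
symmetric under `u ↦ -u`. A path from `u₁` to `-u₁`, followed by its opposite, closes up to an odd
loop with the same energies (`exists_oddMap_of_path`). Conversely, an odd map with maximum `M` joins
some element of the sublevel set to its opposite inside that set. By minimality `u₁` lies in the
same sublevel set, so it is enough that one antipodal pair joined there forces every antipodal pair
to be joined there (`joinedIn_neg_of_joinedIn_neg`).

Two curves give this. Between nonnegative elements, the energy is convex along `((1 - t) u ^ p + t v
^ p) ^ (1 / p)` by Minkowski's inequality (`joinedIn_energySublevel_of_nonneg`). For a sign-changing
`u`, the positive and negative parts are rescaled separately; the energy is concave in a suitable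
parameter, so from `u` at least one of the two arcs, towards the positive or the negative part, does
not leave the sublevel set (`exists_joinedIn_signed`). Hence every element is joined to one of
constant sign, and constant-sign elements are joined to each other up to sign.

Both curves are superpositions `G t (u, v)` with `G t` merely Lipschitz. That such functions stay in
the completion of the test functions and depend continuously on `t` is the analytic part
(`SobolevSpace.exists_comp`, `SobolevSpace.exists_continuousMap_comp`). -/

theorem tendsto_eLpNorm_zero_of_dominated {α : Type*} {m : MeasurableSpace α} {μ : Measure α}
    {q : ℝ} (hq : 0 < q) {F : ℕ → α → ℝ} {b : α → ℝ}
    (hF : ∀ n, AEStronglyMeasurable (F n) μ) (hb : eLpNorm b (ENNReal.ofReal q) μ ≠ ∞)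
    (hbound : ∀ n, ∀ᵐ x ∂μ, |F n x| ≤ b x)
    (hlim : ∀ᵐ x ∂μ, Tendsto (fun n => F n x) atTop (𝓝 0)) :
    Tendsto (fun n => eLpNorm (F n) (ENNReal.ofReal q) μ) atTop (𝓝 0) := by
  have hq0 : ENNReal.ofReal q ≠ 0 := by simpa using hq
  simp only [eLpNorm_eq_lintegral_rpow_enorm_toReal hq0 ENNReal.ofReal_ne_top,
    ENNReal.toReal_ofReal hq.le]
  have hfin := lintegral_rpow_enorm_lt_top_of_eLpNorm_lt_top hq0 ENNReal.ofReal_ne_top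
    (lt_top_iff_ne_top.2 hb)
  rw [ENNReal.toReal_ofReal hq.le] at hfin
  have key : Tendsto (fun n => ∫⁻ x, ‖F n x‖ₑ ^ q ∂μ) atTop (𝓝 (∫⁻ _, 0 ∂μ)) := by
    refine tendsto_lintegral_of_dominated_convergence' (fun x => ‖b x‖ₑ ^ q)
      (fun n => (hF n).enorm.pow_const q) (fun n => ?_) hfin.ne ?_
    · filter_upwards [hbound n] with x hx
      refine ENNReal.rpow_le_rpow ?_ hq.le
      exact enorm_le_iff_norm_le.2 (hx.trans (le_abs_self _))
    · filter_upwards [hlim] with x hx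
      have h1 : Tendsto (fun n => ‖F n x‖ₑ) atTop (𝓝 0) := by simpa using hx.enorm
      simpa [ENNReal.zero_rpow_of_pos hq] using h1.ennrpow_const q
  simpa [ENNReal.zero_rpow_of_pos (inv_pos.2 hq)] using key.ennrpow_const (1 / q)

/-- Dominated convergence in `L^q` with a convergent sequence of bounds. -/
theorem tendsto_eLpNorm_sub_of_dominated {α : Type*} {m : MeasurableSpace α} {μ : Measure α}
    {q : ℝ} (hq : 1 ≤ q) {F G : ℕ → α → ℝ} {f g : α → ℝ}
    (hF : ∀ n, AEStronglyMeasurable (F n) μ) (hf : AEStronglyMeasurable f μ)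
    (hg : AEStronglyMeasurable g μ)
    (hgfin : eLpNorm g (ENNReal.ofReal q) μ ≠ ∞)
    (hFG : ∀ n, ∀ᵐ x ∂μ, |F n x| ≤ G n x) (hfg : ∀ᵐ x ∂μ, |f x| ≤ g x)
    (hGlim : Tendsto (fun n => eLpNorm (G n - g) (ENNReal.ofReal q) μ) atTop (𝓝 0))
    (hlim : ∀ᵐ x ∂μ, Tendsto (fun n => F n x) atTop (𝓝 (f x))) :
    Tendsto (fun n => eLpNorm (F n - f) (ENNReal.ofReal q) μ) atTop (𝓝 0) := by
  have hq0 : 0 < q := by linarith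
  -- Truncating `F n` between `-g` and `g` costs at most `|G n - g|`, which is small in `L^q`; the
  -- truncated sequence has the fixed bound `g`. No pointwise convergence of `G n` is needed.
  set c : ℕ → α → ℝ := fun n x => max (-g x) (min (g x) (F n x)) with hc
  have hcm : ∀ n, AEStronglyMeasurable (c n) μ := fun n => hg.neg.sup (hg.inf (hF n))
  have h2 : Tendsto (fun n => eLpNorm (c n - f) (ENNReal.ofReal q) μ) atTop (𝓝 0) := by
    refine tendsto_eLpNorm_zero_of_dominated hq0 (b := (2 : ℝ) • g)
      (fun n => (hcm n).sub hf) ?_ (fun n => ?_) ?_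
    · rw [eLpNorm_const_smul]
      exact ENNReal.mul_ne_top enorm_ne_top hgfin
    · filter_upwards [hfg] with x hx
      have hx' := abs_le.1 hx
      have hg0 : 0 ≤ g x := (abs_nonneg _).trans hx
      have h3 : c n x ≤ g x := max_le (by linarith) (min_le_left _ _)
      have h4 : -g x ≤ c n x := le_max_left _ _
      simp only [Pi.sub_apply, Pi.smul_apply, smul_eq_mul]
      rw [abs_le]
      constructor <;> linarith
    · filter_upwards [hfg, hlim] with x hx hl
      have hx' := abs_le.1 hx
      have h3 : Tendsto (fun n => c n x) atTop (𝓝 (max (-g x) (min (g x) (f x)))) :=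
        tendsto_const_nhds.max (tendsto_const_nhds.min hl)
      rw [min_eq_right hx'.2, max_eq_right hx'.1] at h3
      simpa using h3.sub_const (f x)
  refine tendsto_of_tendsto_of_tendsto_of_le_of_le tendsto_const_nhds
    (by simpa using hGlim.add h2) (fun _ => zero_le) (fun n => ?_)
  have h5 : F n - f = (F n - c n) + (c n - f) := by simp
  rw [h5]
  refine (eLpNorm_add_le ((hF n).sub (hcm n)) ((hcm n).sub hf) (by simpa using hq)).trans ?_
  gcongr
  refine eLpNorm_mono_ae ?_
  filter_upwards [hFG n, hfg] with x hx hx2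
  have hx' := abs_le.1 hx
  have hg0 : 0 ≤ g x := (abs_nonneg _).trans hx2
  simp only [Pi.sub_apply, Real.norm_eq_abs, hc]
  have h6 := le_abs_self (G n x - g x)
  have h7 := abs_nonneg (G n x - g x)
  rcases max_cases (-g x) (min (g x) (F n x)) with h | h <;>
    rcases min_cases (g x) (F n x) with h' | h' <;> rw [abs_le] <;> constructor <;> linarith

/-! ### Smooth approximation of Lipschitz functions -/

/-- Mollification averages translates of `G`, hence keeps its Lipschitz constant and moves values by
at most `K` times the radius. Subtracting the value at the origin restores `H n 0 = 0`, without
which composition with test functions would lose the compact support. -/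
theorem exists_contDiff_approx_of_lipschitz {K : NNReal} {G : ℝ × ℝ → ℝ} (hG : LipschitzWith K G)
    (h0 : G 0 = 0) :
    ∃ H : ℕ → ℝ × ℝ → ℝ, (∀ n, ContDiff ℝ (⊤ : ℕ∞) (H n)) ∧ (∀ n, LipschitzWith K (H n)) ∧
      (∀ n, H n 0 = 0) ∧ ∀ x, Tendsto (fun n => H n x) atTop (𝓝 (G x)) := by
  let ρ : ℕ → ContDiffBump (0 : ℝ × ℝ) := fun n =>
    ⟨1 / ((n : ℝ) + 1) / 2, 1 / ((n : ℝ) + 1), by positivity, half_lt_self (by positivity)⟩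
  let L := ContinuousLinearMap.lsmul ℝ ℝ (E := ℝ)
  let C : ℕ → ℝ × ℝ → ℝ := fun n => convolution ((ρ n).normed volume) G L volume
  have hloc : LocallyIntegrable G (volume : Measure (ℝ × ℝ)) := hG.continuous.locallyIntegrable
  have hex : ∀ n, ConvolutionExists ((ρ n).normed volume) G L volume := fun n =>
    (ρ n).hasCompactSupport_normed.convolutionExists_left L (ρ n).continuous_normed hloc
  have hsmooth : ∀ n, ContDiff ℝ (⊤ : ℕ∞) (C n) := fun n =>
    (ρ n).hasCompactSupport_normed.contDiff_convolution_left L (ρ n).contDiff_normed hloc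
  have hlip : ∀ n, LipschitzWith K (C n) := by
    intro n
    refine LipschitzWith.of_dist_le_mul fun x y => ?_
    have hint : Integrable ((ρ n).normed volume) (volume : Measure (ℝ × ℝ)) :=
      (ρ n).continuous_normed.integrable_of_hasCompactSupport (ρ n).hasCompactSupport_normed
    have h1 : C n x - C n y =
        ∫ t, (ρ n).normed volume t * (G (x - t) - G (y - t)) := by
      change (∫ t, _) - (∫ t, _) = _
      rw [← integral_sub (hex n x) (hex n y)]
      refine integral_congr_ae (Eventually.of_forall fun t => ?_)
      simp [L, mul_sub]
    have h2 : ∫ t, (ρ n).normed volume t * (K * dist x y) = K * dist x y := by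
      rw [integral_mul_const, (ρ n).integral_normed, one_mul]
    rw [Real.dist_eq, h1, ← Real.norm_eq_abs, ← h2]
    refine norm_integral_le_of_norm_le (hint.mul_const _) (Eventually.of_forall fun t => ?_)
    rw [norm_mul, Real.norm_of_nonneg ((ρ n).nonneg_normed t)]
    refine mul_le_mul_of_nonneg_left ?_ ((ρ n).nonneg_normed t)
    have := hG.dist_le_mul (x - t) (y - t)
    rwa [dist_sub_right, Real.dist_eq] at this
  have hconv : ∀ x, Tendsto (fun n => C n x) atTop (𝓝 (G x)) := by
    intro x
    rw [tendsto_iff_dist_tendsto_zero]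
    refine squeeze_zero (g := fun n : ℕ => (K : ℝ) * (1 / ((n : ℝ) + 1)))
      (fun _ => dist_nonneg) (fun n => ?_)
      (by simpa using tendsto_one_div_add_atTop_nhds_zero_nat.const_mul (K : ℝ))
    refine ContDiffBump.dist_normed_convolution_le hG.continuous.aestronglyMeasurable
      fun y hy => (hG.dist_le_mul y x).trans ?_
    exact mul_le_mul_of_nonneg_left (le_of_lt hy) K.2
  refine ⟨fun n x => C n x - C n 0, fun n => (hsmooth n).sub contDiff_const, fun n => ?_,
    fun n => sub_self _, fun x => ?_⟩
  · refine LipschitzWith.of_dist_le_mul fun x y => ?_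
    rw [dist_sub_right]
    exact (hlip n).dist_le_mul x y
  · simpa [h0] using (hconv x).sub (hconv 0)

/-! ### Weighted Minkowski inequalities on two points -/

/-- Minkowski's inequality in `ℓ^p` of two points, the weights being absorbed into the entries as `c
^ (1 / p)` and `d ^ (1 / p)`. -/
theorem weighted_Lp_add_le {p : ℝ} (hp : 1 < p) {c d : ℝ} (hc : 0 ≤ c) (hd : 0 ≤ d)
    (a b a' b' : ℝ) :
    (c * |a + a'| ^ p + d * |b + b'| ^ p) ^ (1 / p) ≤
      (c * |a| ^ p + d * |b| ^ p) ^ (1 / p) + (c * |a'| ^ p + d * |b'| ^ p) ^ (1 / p) := by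
  have hp0 : p ≠ 0 := by linarith
  have key : ∀ {w : ℝ}, 0 ≤ w → ∀ x : ℝ, |w ^ (1 / p) * x| ^ p = w * |x| ^ p := by
    intro w hw x
    rw [abs_mul, Real.mul_rpow (abs_nonneg _) (abs_nonneg _),
      abs_of_nonneg (Real.rpow_nonneg hw _), ← Real.rpow_mul hw, one_div_mul_cancel hp0,
      Real.rpow_one]
  have h := Real.Lp_add_le Finset.univ ![c ^ (1 / p) * a, d ^ (1 / p) * b]
    ![c ^ (1 / p) * a', d ^ (1 / p) * b'] hp.le
  simp only [Fin.sum_univ_two, Matrix.cons_val_zero, Matrix.cons_val_one, ← mul_add, key hc,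
    key hd] at h
  exact h

/-- The `ℓ^p` mean of `|a|` and `|b|` with weights `1 - t` and `t`. -/
def lpMean (p t : ℝ) (a b : ℝ) : ℝ := ((1 - t) * |a| ^ p + t * |b| ^ p) ^ (1 / p)

theorem lpMean_nonneg (p : ℝ) {t : ℝ} (ht : t ∈ Icc (0 : ℝ) 1) (a b : ℝ) : 0 ≤ lpMean p t a b := by
  have h1 := sub_nonneg.2 ht.2
  have h2 := ht.1
  unfold lpMean
  positivity

theorem lpMean_rpow {p : ℝ} (hp : 1 < p) {t : ℝ} (ht : t ∈ Icc (0 : ℝ) 1) (a b : ℝ) :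
    lpMean p t a b ^ p = (1 - t) * |a| ^ p + t * |b| ^ p := by
  have h1 := sub_nonneg.2 ht.2
  have h2 := ht.1
  unfold lpMean
  rw [← Real.rpow_mul (by positivity), one_div_mul_cancel (by linarith), Real.rpow_one]

theorem abs_lpMean_sub_le {p : ℝ} (hp : 1 < p) {t : ℝ} (ht : t ∈ Icc (0 : ℝ) 1)
    (a b a' b' : ℝ) : |lpMean p t a b - lpMean p t a' b'| ≤ lpMean p t (a - a') (b - b') := by
  have h1 := weighted_Lp_add_le hp (sub_nonneg.2 ht.2) ht.1 (a - a') (b - b') a' b'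
  have h2 := weighted_Lp_add_le hp (sub_nonneg.2 ht.2) ht.1 (a' - a) (b' - b) a b
  rw [abs_sub_comm a' a, abs_sub_comm b' b] at h2
  simp only [sub_add_cancel] at h1 h2
  unfold lpMean
  rw [abs_le]
  constructor <;> linarith

/-- The pointwise form of the convexity of the energy: dividing by the kernel and integrating bounds
the energy of the mean. -/
theorem abs_lpMean_sub_rpow_le {p : ℝ} (hp : 1 < p) {t : ℝ} (ht : t ∈ Icc (0 : ℝ) 1)
    (a b a' b' : ℝ) : |lpMean p t a b - lpMean p t a' b'| ^ p ≤
      (1 - t) * |a - a'| ^ p + t * |b - b'| ^ p := by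
  rw [← lpMean_rpow hp ht]
  exact Real.rpow_le_rpow (abs_nonneg _) (abs_lpMean_sub_le hp ht a b a' b') (by linarith)

theorem lipschitzWith_lpMean {p : ℝ} (hp : 1 < p) {t : ℝ} (ht : t ∈ Icc (0 : ℝ) 1) :
    LipschitzWith 1 (fun r : ℝ × ℝ => lpMean p t r.1 r.2) := by
  have hp0 : 0 < p := by linarith
  refine LipschitzWith.of_dist_le_mul fun x y => ?_
  rw [Real.dist_eq, NNReal.coe_one, one_mul]
  refine (abs_lpMean_sub_le hp ht _ _ _ _).trans ?_
  rw [← Real.rpow_le_rpow_iff (lpMean_nonneg p ht _ _) dist_nonneg hp0, lpMean_rpow hp ht]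
  have h1 : |x.1 - y.1| ^ p ≤ dist x y ^ p :=
    Real.rpow_le_rpow (abs_nonneg _) (le_max_left _ _) hp0.le
  have h2 : |x.2 - y.2| ^ p ≤ dist x y ^ p :=
    Real.rpow_le_rpow (abs_nonneg _) (le_max_right _ _) hp0.le
  have h3 := mul_le_mul_of_nonneg_left h1 (sub_nonneg.2 ht.2)
  have h4 := mul_le_mul_of_nonneg_left h2 ht.1
  linarith

/-- `(c, d) ↦ (c^(1/p) x + d^(1/p) y)^p` is concave on the quadrant. -/
theorem concave_rpow_add_rpow {p : ℝ} (hp : 1 < p) {t : ℝ} (ht : t ∈ Icc (0 : ℝ) 1)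
    {c d c' d' x y : ℝ} (hc : 0 ≤ c) (hd : 0 ≤ d) (hc' : 0 ≤ c') (hd' : 0 ≤ d')
    (hx : 0 ≤ x) (hy : 0 ≤ y) :
    (1 - t) * (c ^ (1 / p) * x + d ^ (1 / p) * y) ^ p +
        t * (c' ^ (1 / p) * x + d' ^ (1 / p) * y) ^ p ≤
      (((1 - t) * c + t * c') ^ (1 / p) * x + ((1 - t) * d + t * d') ^ (1 / p) * y) ^ p := by
  have hp0 : 0 < p := by linarith
  have h1 := sub_nonneg.2 ht.2
  have h2 := ht.1
  -- Minkowski with weights `1 - t`, `t` for the pairs `(c ^ (1 / p) x, c' ^ (1 / p) x)` and `(d ^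
  -- (1 / p) y, d' ^ (1 / p) y)`; the norm of each pair is explicit.
  have h := weighted_Lp_add_le hp h1 h2 (c ^ (1 / p) * x) (c' ^ (1 / p) * x)
    (d ^ (1 / p) * y) (d' ^ (1 / p) * y)
  have key : ∀ {e e' z : ℝ}, 0 ≤ e → 0 ≤ e' → 0 ≤ z →
      ((1 - t) * |e ^ (1 / p) * z| ^ p + t * |e' ^ (1 / p) * z| ^ p) ^ (1 / p) =
        ((1 - t) * e + t * e') ^ (1 / p) * z := by
    intro e e' z he he' hz
    have aux : ∀ {w : ℝ}, 0 ≤ w → |w ^ (1 / p) * z| ^ p = w * z ^ p := by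
      intro w hw
      rw [abs_of_nonneg (by positivity), Real.mul_rpow (by positivity) hz, ← Real.rpow_mul hw,
        one_div_mul_cancel hp0.ne', Real.rpow_one]
    rw [aux he, aux he', ← mul_assoc, ← mul_assoc, ← add_mul,
      Real.mul_rpow (by positivity) (by positivity), ← Real.rpow_mul hz,
      mul_one_div_cancel hp0.ne', Real.rpow_one]
  rw [key hc hc' hx, key hd hd' hy, abs_of_nonneg (by positivity),
    abs_of_nonneg (by positivity)] at h
  have h3 := Real.rpow_le_rpow (by positivity) h hp0.le
  rwa [← Real.rpow_mul (by positivity), one_div_mul_cancel hp0.ne', Real.rpow_one] at h3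

/-! ### Lipschitz superposition operators on the Sobolev space -/

theorem eLpNorm_le_of_abs_le {α : Type*} {m : MeasurableSpace α} {μ : Measure α} {q : ℝ}
    (hq : 1 ≤ q) {K : NNReal} {f U V : α → ℝ} (hU : AEStronglyMeasurable U μ)
    (hV : AEStronglyMeasurable V μ) (h : ∀ x, |f x| ≤ K * (|U x| + |V x|)) :
    eLpNorm f (ENNReal.ofReal q) μ ≤
      K * (eLpNorm U (ENNReal.ofReal q) μ + eLpNorm V (ENNReal.ofReal q) μ) := by
  have h1 : eLpNorm f (ENNReal.ofReal q) μ ≤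
      eLpNorm ((K : ℝ) • ((fun x => |U x|) + fun x => |V x|)) (ENNReal.ofReal q) μ :=
    eLpNorm_mono_real fun x => by simpa using h x
  refine h1.trans ?_
  rw [eLpNorm_const_smul]
  have h2 : ‖(K : ℝ)‖ₑ = K := by simp
  rw [h2]
  gcongr
  refine (eLpNorm_add_le hU.norm hV.norm (by simpa using hq)).trans ?_
  exact add_le_add (eLpNorm_norm U).le (eLpNorm_norm V).le

/-- Stated for a general measure because it serves twice: for the functions themselves under
Lebesgue measure, and for their differences `g z.1 - g z.2` under `gagliardoMeasure`. -/
theorem tendsto_eLpNorm_of_abs_le {α : Type*} {m : MeasurableSpace α} {μ : Measure α}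
    {q : ℝ} (hq : 1 ≤ q) {K : NNReal} {U V F : ℕ → α → ℝ} {u v f : α → ℝ}
    (hU : ∀ n, AEStronglyMeasurable (U n) μ) (hV : ∀ n, AEStronglyMeasurable (V n) μ)
    (hF : ∀ n, AEStronglyMeasurable (F n) μ) (hu : AEStronglyMeasurable u μ)
    (hv : AEStronglyMeasurable v μ) (hf : AEStronglyMeasurable f μ)
    (hufin : eLpNorm u (ENNReal.ofReal q) μ ≠ ∞) (hvfin : eLpNorm v (ENNReal.ofReal q) μ ≠ ∞)
    (hUlim : Tendsto (fun n => eLpNorm (u - U n) (ENNReal.ofReal q) μ) atTop (𝓝 0))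
    (hVlim : Tendsto (fun n => eLpNorm (v - V n) (ENNReal.ofReal q) μ) atTop (𝓝 0))
    (hFb : ∀ n x, |F n x| ≤ K * (|U n x| + |V n x|)) (hfb : ∀ x, |f x| ≤ K * (|u x| + |v x|))
    (hlim : ∀ᵐ x ∂μ, Tendsto (fun n => F n x) atTop (𝓝 (f x))) :
    Tendsto (fun n => eLpNorm (f - F n) (ENNReal.ofReal q) μ) atTop (𝓝 0) := by
  have key : Tendsto (fun n => eLpNorm (F n - f) (ENNReal.ofReal q) μ) atTop (𝓝 0) := by
    refine tendsto_eLpNorm_sub_of_dominated hq (G := fun n x => K * (|U n x| + |V n x|))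
      (g := fun x => K * (|u x| + |v x|)) hF hf ((hu.norm.add hv.norm).const_mul _) ?_
      (fun n => Eventually.of_forall (hFb n)) (Eventually.of_forall hfb) ?_ hlim
    · refine ne_top_of_le_ne_top ?_ (eLpNorm_le_of_abs_le (K := K) hq hu hv fun x => ?_)
      · exact ENNReal.mul_ne_top ENNReal.coe_ne_top (ENNReal.add_ne_top.2 ⟨hufin, hvfin⟩)
      · rw [abs_of_nonneg (by positivity)]
    · have h0 := ENNReal.Tendsto.const_mul (a := (K : ℝ≥0∞)) (hUlim.add hVlim)
        (Or.inr ENNReal.coe_ne_top)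
      rw [add_zero, mul_zero] at h0
      refine tendsto_of_tendsto_of_tendsto_of_le_of_le tendsto_const_nhds h0
        (fun _ => zero_le) (fun n => ?_)
      refine eLpNorm_le_of_abs_le hq (hu.sub (hU n)) (hv.sub (hV n)) fun x => ?_
      have h1 := abs_abs_sub_abs_le_abs_sub (U n x) (u x)
      have h2 := abs_abs_sub_abs_le_abs_sub (V n x) (v x)
      rw [abs_sub_comm (U n x)] at h1
      rw [abs_sub_comm (V n x)] at h2
      simp only [Pi.sub_apply]
      rw [← mul_sub, abs_mul, NNReal.abs_eq]
      refine mul_le_mul_of_nonneg_left ?_ K.2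
      rw [add_sub_add_comm]
      exact (abs_add_le _ _).trans (add_le_add h1 h2)
  refine key.congr fun n => ?_
  rw [← eLpNorm_neg, neg_sub]

theorem abs_sub_le_of_lipschitzWith {K : NNReal} {G : ℝ × ℝ → ℝ} (hG : LipschitzWith K G)
    (a b a' b' : ℝ) : |G (a, b) - G (a', b')| ≤ K * (|a - a'| + |b - b'|) := by
  refine (hG.dist_le_mul (a, b) (a', b')).trans (mul_le_mul_of_nonneg_left ?_ K.2)
  exact max_le_add_of_nonneg (abs_nonneg _) (abs_nonneg _)

theorem abs_le_of_lipschitzWith {K : NNReal} {G : ℝ × ℝ → ℝ} (hG : LipschitzWith K G)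
    (h0 : G 0 = 0) (a b : ℝ) : |G (a, b)| ≤ K * (|a| + |b|) := by
  have h := abs_sub_le_of_lipschitzWith hG a b 0 0
  rw [show ((0 : ℝ), (0 : ℝ)) = 0 from rfl, h0] at h
  simpa using h

theorem IsTestFunction.comp {N : ℕ} {Ω : Set (Eucl N)} {φ ψ : Eucl N → ℝ}
    (hφ : IsTestFunction Ω φ) (hψ : IsTestFunction Ω ψ) {H : ℝ × ℝ → ℝ}
    (hH : ContDiff ℝ (⊤ : ℕ∞) H) (h0 : H 0 = 0) :
    IsTestFunction Ω (fun x => H (φ x, ψ x)) := by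
  refine ⟨hH.comp (hφ.1.prodMk hψ.1),
    hφ.2.1.comp₂_left (m := fun a b => H (a, b)) hψ.2.1 h0, ?_⟩
  have h1 : Function.support (fun x => H (φ x, ψ x)) ⊆
      Function.support φ ∪ Function.support ψ := by
    intro x hx
    by_contra hn
    simp only [mem_union, Function.mem_support, not_or, not_not] at hn
    exact hx (by simp only [hn.1, hn.2]; exact h0)
  refine (closure_mono h1).trans ?_
  rw [closure_union]
  exact union_subset hφ.2.2 hψ.2.2

theorem exists_subseq_tendsto_ae {α : Type*} {m : MeasurableSpace α} {μ : Measure α} {q : ℝ≥0∞}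
    (hq : q ≠ 0) {U V : ℕ → α → ℝ} {u v : α → ℝ}
    (hU : ∀ n, AEStronglyMeasurable (U n) μ) (hV : ∀ n, AEStronglyMeasurable (V n) μ)
    (hu : AEStronglyMeasurable u μ) (hv : AEStronglyMeasurable v μ)
    (hUlim : Tendsto (fun n => eLpNorm (u - U n) q μ) atTop (𝓝 0))
    (hVlim : Tendsto (fun n => eLpNorm (v - V n) q μ) atTop (𝓝 0)) :
    ∃ ns : ℕ → ℕ, StrictMono ns ∧ ∀ᵐ x ∂μ, Tendsto (fun i => U (ns i) x) atTop (𝓝 (u x)) ∧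
      Tendsto (fun i => V (ns i) x) atTop (𝓝 (v x)) := by
  have hU' : Tendsto (fun n => eLpNorm (U n - u) q μ) atTop (𝓝 0) :=
    hUlim.congr fun n => by rw [← eLpNorm_neg, neg_sub]
  have hV' : Tendsto (fun n => eLpNorm (V n - v) q μ) atTop (𝓝 0) :=
    hVlim.congr fun n => by rw [← eLpNorm_neg, neg_sub]
  obtain ⟨ms, hms, h1⟩ := (tendstoInMeasure_of_tendsto_eLpNorm hq hU hu hU').exists_seq_tendsto_ae
  obtain ⟨ks, hks, h2⟩ := (tendstoInMeasure_of_tendsto_eLpNorm hq (fun n => hV (ms n)) hv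
    (hV'.comp hms.tendsto_atTop)).exists_seq_tendsto_ae
  refine ⟨ms ∘ ks, hms.comp hks, ?_⟩
  filter_upwards [h1, h2] with x hx1 hx2
  exact ⟨hx1.comp hks.tendsto_atTop, hx2⟩

theorem ae_fst_snd {N : ℕ} {s p : ℝ} {P : Eucl N → Prop} (h : ∀ᵐ x, P x) :
    ∀ᵐ z ∂gagliardoMeasure N s p, P z.1 ∧ P z.2 := by
  refine (gagliardoMeasure_absolutelyContinuous N s p).ae_le ?_
  have h1 := (Measure.quasiMeasurePreserving_fst (μ := (volume : Measure (Eucl N)))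
    (ν := (volume : Measure (Eucl N)))).ae h
  have h2 := (Measure.quasiMeasurePreserving_snd (μ := (volume : Measure (Eucl N)))
    (ν := (volume : Measure (Eucl N)))).ae h
  exact h1.and h2

variable {N : ℕ} {Ω : Set (Eucl N)} {s p : ℝ}

/-- With `φ i`, `ψ i` test functions approximating `u`, `v`, and `H i` smooth approximations of `G`
with the same Lipschitz constant, the functions `H i (φ i, ψ i)` are test functions. They converge
to `G (u, v)` almost everywhere along a subsequence, and the convergent Lipschitz bounds upgrade
this to both norms. -/
theorem SobolevSpace.exists_comp [hp : Fact (1 < p)] {K : NNReal} {G : ℝ × ℝ → ℝ}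
    (hG : LipschitzWith K G) (h0 : G 0 = 0) (u v : SobolevSpace Ω s p) :
    ∃ w : SobolevSpace Ω s p, ⇑w.toLp =ᵐ[volume] fun x => G (u.toLp x, v.toLp x) := by
  obtain ⟨hufin, φ', hφ', hφ1', hφ2'⟩ := (Subtype.prop u : u.toLp ∈ sobolevSubmodule Ω s p)
  obtain ⟨hvfin, ψ', hψ', hψ1', hψ2'⟩ := (Subtype.prop v : v.toLp ∈ sobolevSubmodule Ω s p)
  have hq0 : ENNReal.ofReal p ≠ 0 := by simpa using zero_lt_one.trans hp.out
  have hum := Lp.aestronglyMeasurable u.toLp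
  have hvm := Lp.aestronglyMeasurable v.toLp
  obtain ⟨ns, hns, hae⟩ := exists_subseq_tendsto_ae hq0
    (fun n => (hφ' n).aestronglyMeasurable) (fun n => (hψ' n).aestronglyMeasurable) hum hvm
    hφ1' hψ1'
  obtain ⟨H, hHs, hHl, hH0, hHlim⟩ := exists_contDiff_approx_of_lipschitz hG h0
  set φ : ℕ → Eucl N → ℝ := fun i => φ' (ns i) with hφd
  set ψ : ℕ → Eucl N → ℝ := fun i => ψ' (ns i) with hψd
  have hφ : ∀ i, IsTestFunction Ω (φ i) := fun i => hφ' _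
  have hψ : ∀ i, IsTestFunction Ω (ψ i) := fun i => hψ' _
  have hφ1 := hφ1'.comp hns.tendsto_atTop
  have hφ2 := hφ2'.comp hns.tendsto_atTop
  have hψ1 := hψ1'.comp hns.tendsto_atTop
  have hψ2 := hψ2'.comp hns.tendsto_atTop
  set F : ℕ → Eucl N → ℝ := fun i x => H i (φ i x, ψ i x) with hFd
  set f : Eucl N → ℝ := fun x => G (u.toLp x, v.toLp x) with hfd
  have hF : ∀ i, IsTestFunction Ω (F i) := fun i => (hφ i).comp (hψ i) (hHs i) (hH0 i)
  have hfm : AEStronglyMeasurable f volume :=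
    hG.continuous.comp_aestronglyMeasurable (hum.prodMk hvm)
  have hlim : ∀ᵐ x, Tendsto (fun i => F i x) atTop (𝓝 (f x)) := by
    filter_upwards [hae] with x hx
    have h1 : Tendsto (fun i => H i (u.toLp x, v.toLp x)) atTop (𝓝 (f x)) := hHlim _
    have h2 : Tendsto (fun i => (K : ℝ) * dist (φ i x, ψ i x) (u.toLp x, v.toLp x)) atTop
        (𝓝 0) := by
      have := (tendsto_iff_dist_tendsto_zero.1 (hx.1.prodMk_nhds hx.2)).const_mul (K : ℝ)
      simpa using this
    refine tendsto_of_tendsto_of_dist h1 (squeeze_zero (fun _ => dist_nonneg) (fun i => ?_) h2)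
    rw [dist_comm]
    exact (hHl i).dist_le_mul _ _
  have hac := gagliardoMeasure_absolutelyContinuous N s p
  have hD : ∀ {g : Eucl N → ℝ}, AEStronglyMeasurable g volume →
      AEStronglyMeasurable (fun z : Eucl N × Eucl N => g z.1 - g z.2) (gagliardoMeasure N s p) :=
    fun hg => (aestronglyMeasurable_diff hg).mono_ac hac
  have hLp : MemLp f (ENNReal.ofReal p) volume := by
    refine ⟨hfm, lt_of_le_of_lt (eLpNorm_le_of_abs_le (K := K) hp.out.le hum hvm
      fun x => abs_le_of_lipschitzWith hG h0 _ _) ?_⟩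
    exact ENNReal.mul_lt_top ENNReal.coe_lt_top
      (ENNReal.add_lt_top.2 ⟨(Lp.memLp u.toLp).2, (Lp.memLp v.toLp).2⟩)
  have hco := hLp.coeFn_toLp
  have hufin' := hufin
  have hvfin' := hvfin
  rw [gagliardoSeminorm_eq_eLpNorm s hp.out] at hufin' hvfin'
  have hsub : ∀ g : Eucl N → ℝ, (⇑(hLp.toLp f) - g) =ᵐ[volume] f - g := fun g =>
    hco.sub (EventuallyEq.refl _ _)
  refine ⟨(⟨hLp.toLp f, ?_, F, hF, ?_, ?_⟩ : ↥(sobolevSubmodule Ω s p)), hco⟩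
  · rw [gagliardoSeminorm_congr s hco, gagliardoSeminorm_eq_eLpNorm s hp.out]
    refine lt_of_le_of_lt (eLpNorm_le_of_abs_le (K := K) hp.out.le (hD hum) (hD hvm)
      fun z => abs_sub_le_of_lipschitzWith hG _ _ _ _) ?_
    exact ENNReal.mul_lt_top ENNReal.coe_lt_top (ENNReal.add_lt_top.2 ⟨hufin', hvfin'⟩)
  · simp only [eLpNorm_congr_ae (hsub _)]
    exact tendsto_eLpNorm_of_abs_le hp.out.le (fun n => (hφ n).aestronglyMeasurable)
      (fun n => (hψ n).aestronglyMeasurable) (fun n => (hF n).aestronglyMeasurable) hum hvm hfm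
      (Lp.memLp u.toLp).2.ne (Lp.memLp v.toLp).2.ne hφ1 hψ1
      (fun n x => abs_le_of_lipschitzWith (hHl n) (hH0 n) _ _)
      (fun x => abs_le_of_lipschitzWith hG h0 _ _) hlim
  · simp only [gagliardoSeminorm_congr s (hsub _)]
    have hsd : ∀ g h : Eucl N → ℝ, (fun z : Eucl N × Eucl N => (g - h) z.1 - (g - h) z.2) =
        (fun z => g z.1 - g z.2) - fun z => h z.1 - h z.2 := by
      intro g h
      ext z
      simp only [Pi.sub_apply]
      ring
    simp only [Function.comp_def, gagliardoSeminorm_eq_eLpNorm s hp.out, hsd] at hφ2 hψ2 ⊢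
    refine tendsto_eLpNorm_of_abs_le hp.out.le (fun n => hD (hφ n).aestronglyMeasurable)
      (fun n => hD (hψ n).aestronglyMeasurable) (fun n => hD (hF n).aestronglyMeasurable)
      (hD hum) (hD hvm) (hD hfm) hufin'.ne hvfin'.ne hφ2 hψ2
      (fun n x => abs_sub_le_of_lipschitzWith (hHl n) _ _ _ _)
      (fun x => abs_sub_le_of_lipschitzWith hG _ _ _ _) ?_
    filter_upwards [ae_fst_snd hlim] with z hz
    exact hz.1.sub hz.2

/-- Since `K` does not depend on `t`, the differences are dominated by `2 K (|u x - u y| + |v x - v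
y|)`, so pointwise continuity in `t` suffices for continuity in the Gagliardo norm. -/
theorem SobolevSpace.exists_continuousMap_comp [NeZero N] [hp : Fact (1 < p)] {X : Type*}
    [TopologicalSpace X] [FirstCountableTopology X] {K : NNReal} {G : X → ℝ × ℝ → ℝ}
    (hG : ∀ t, LipschitzWith K (G t)) (h0 : ∀ t, G t 0 = 0) (hc : ∀ r, Continuous fun t => G t r)
    (u v : SobolevSpace Ω s p) :
    ∃ w : C(X, SobolevSpace Ω s p),
      ∀ t, ⇑(w t).toLp =ᵐ[volume] fun x => G t (u.toLp x, v.toLp x) := by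
  choose w hw using fun t => exists_comp (hG t) (h0 t) u v
  refine ⟨⟨w, ?_⟩, hw⟩
  refine SeqContinuous.continuous fun x a hx => ?_
  rw [tendsto_iff_norm_sub_tendsto_zero]
  have hac := gagliardoMeasure_absolutelyContinuous N s p
  have hD : ∀ {g : Eucl N → ℝ}, AEStronglyMeasurable g volume →
      AEStronglyMeasurable (fun z : Eucl N × Eucl N => g z.1 - g z.2) (gagliardoMeasure N s p) :=
    fun hg => (aestronglyMeasurable_diff hg).mono_ac hac
  have hum := Lp.aestronglyMeasurable u.toLp
  have hvm := Lp.aestronglyMeasurable v.toLp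
  have hfm : ∀ t, AEStronglyMeasurable (fun x => G t (u.toLp x, v.toLp x)) volume := fun t =>
    (hG t).continuous.comp_aestronglyMeasurable (hum.prodMk hvm)
  have heq : ∀ n, ⇑(w (x n) - w a).toLp =ᵐ[volume]
      (fun y => G (x n) (u.toLp y, v.toLp y)) - fun y => G a (u.toLp y, v.toLp y) := fun n =>
    (Lp.coeFn_sub (w (x n)).toLp (w a).toLp).trans ((hw (x n)).sub (hw a))
  have key : Tendsto (fun n => gagliardoSeminorm s p (w (x n) - w a).toLp) atTop (𝓝 0) := by
    simp only [gagliardoSeminorm_congr s (heq _), gagliardoSeminorm_eq_eLpNorm s hp.out]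
    have hufin := u.gagliardoSeminorm_ne_top
    have hvfin := v.gagliardoSeminorm_ne_top
    rw [gagliardoSeminorm_eq_eLpNorm s hp.out] at hufin hvfin
    refine tendsto_eLpNorm_zero_of_dominated (by linarith [hp.out])
      (b := fun z => ((2 * K : NNReal) : ℝ) *
        (|u.toLp z.1 - u.toLp z.2| + |v.toLp z.1 - v.toLp z.2|))
      (fun n => hD ((hfm _).sub (hfm _))) ?_ (fun n => Eventually.of_forall fun z => ?_)
      (Eventually.of_forall fun z => ?_)
    · refine ne_top_of_le_ne_top ?_ (eLpNorm_le_of_abs_le (K := 2 * K) hp.out.le (hD hum) (hD hvm)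
        fun z => ?_)
      · exact ENNReal.mul_ne_top ENNReal.coe_ne_top (ENNReal.add_ne_top.2 ⟨hufin, hvfin⟩)
      · rw [abs_of_nonneg (by positivity)]
    · have h1 := abs_sub_le_of_lipschitzWith (hG (x n)) (u.toLp z.1) (v.toLp z.1)
        (u.toLp z.2) (v.toLp z.2)
      have h2 := abs_sub_le_of_lipschitzWith (hG a) (u.toLp z.1) (v.toLp z.1)
        (u.toLp z.2) (v.toLp z.2)
      simp only [Pi.sub_apply, NNReal.coe_mul, NNReal.coe_ofNat]
      rw [sub_sub_sub_comm]
      refine (abs_sub _ _).trans ?_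
      linarith
    · have h3 : ∀ r, Tendsto (fun n => G (x n) r) atTop (𝓝 (G a r)) := fun r =>
        ((hc r).tendsto a).comp hx
      simpa using ((h3 (u.toLp z.1, v.toLp z.1)).sub_const (G a (u.toLp z.1, v.toLp z.1))).sub
        ((h3 (u.toLp z.2, v.toLp z.2)).sub_const (G a (u.toLp z.2, v.toLp z.2)))
  have h := (ENNReal.tendsto_toReal ENNReal.zero_ne_top).comp key
  simpa [Function.comp_def, norm_def] using h

/-! ### The energy as a Bochner integral -/

/-- The integrand of the Gagliardo energy. -/
def energyDensity (s p : ℝ) (u : Eucl N → ℝ) (z : Eucl N × Eucl N) : ℝ :=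
  |u z.1 - u z.2| ^ p / ‖z.1 - z.2‖ ^ ((N : ℝ) + s * p)

theorem energyDensity_nonneg (s p : ℝ) (u : Eucl N → ℝ) (z : Eucl N × Eucl N) :
    0 ≤ energyDensity s p u z := by
  unfold energyDensity
  positivity

namespace SobolevSpace

theorem toLp_injective [Fact (1 < p)] :
    Function.Injective (toLp : SobolevSpace Ω s p → _) := Subtype.val_injective

theorem ext_ae [Fact (1 < p)] {u v : SobolevSpace Ω s p} (h : ⇑u.toLp =ᵐ[volume] ⇑v.toLp) :
    u = v := toLp_injective (Lp.ext h)

theorem coeFn_neg [Fact (1 < p)] (u : SobolevSpace Ω s p) :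
    ⇑(-u).toLp =ᵐ[volume] -⇑u.toLp := Lp.coeFn_neg u.toLp

theorem integrable_energyDensity [NeZero N] [hp : Fact (1 < p)] (u : SobolevSpace Ω s p) :
    Integrable (energyDensity s p u.toLp) := by
  have hm := aestronglyMeasurable_diff (Lp.aestronglyMeasurable u.toLp)
  have hp0 : 0 < p := by linarith [hp.out]
  have h1 : AEMeasurable (energyDensity s p u.toLp) :=
    (hm.aemeasurable.abs.pow_const p).div
      ((by fun_prop : Measurable fun z : Eucl N × Eucl N =>
        ‖z.1 - z.2‖ ^ ((N : ℝ) + s * p)).aemeasurable (μ := volume))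
  refine ⟨h1.aestronglyMeasurable, ?_⟩
  rw [hasFiniteIntegral_iff_ofReal (Eventually.of_forall (energyDensity_nonneg s p _))]
  have h2 := u.gagliardoSeminorm_ne_top
  rw [gagliardoSeminorm, Ne, ENNReal.rpow_eq_top_iff_of_pos (by positivity)] at h2
  exact lt_top_iff_ne_top.2 h2

theorem norm_rpow_eq_integral [NeZero N] [Fact (1 < p)] (u : SobolevSpace Ω s p) :
    ‖u‖ ^ p = ∫ z, energyDensity s p u.toLp z := by
  rw [norm_rpow, integral_eq_lintegral_of_nonneg_ae
    (Eventually.of_forall (energyDensity_nonneg s p _)) u.integrable_energyDensity.1]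
  rfl

theorem norm_rpow_le_of_ae_le [NeZero N] [Fact (1 < p)] {c d : ℝ} {u v w : SobolevSpace Ω s p}
    (h : ∀ᵐ z, energyDensity s p w.toLp z ≤
      c * energyDensity s p u.toLp z + d * energyDensity s p v.toLp z) :
    ‖w‖ ^ p ≤ c * ‖u‖ ^ p + d * ‖v‖ ^ p := by
  have hu := u.integrable_energyDensity.const_mul c
  have hv := v.integrable_energyDensity.const_mul d
  simp only [norm_rpow_eq_integral]
  rw [← integral_const_mul, ← integral_const_mul, ← integral_add hu hv]
  exact integral_mono_ae w.integrable_energyDensity (hu.add hv) h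

theorem le_norm_rpow_of_ae_le [NeZero N] [Fact (1 < p)] {c d : ℝ} {u v w : SobolevSpace Ω s p}
    (h : ∀ᵐ z, c * energyDensity s p u.toLp z + d * energyDensity s p v.toLp z ≤
      energyDensity s p w.toLp z) :
    c * ‖u‖ ^ p + d * ‖v‖ ^ p ≤ ‖w‖ ^ p := by
  have hu := u.integrable_energyDensity.const_mul c
  have hv := v.integrable_energyDensity.const_mul d
  simp only [norm_rpow_eq_integral]
  rw [← integral_const_mul, ← integral_const_mul, ← integral_add hu hv]
  exact integral_mono_ae (hu.add hv) w.integrable_energyDensity h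

theorem ae_fst_snd_volume {P : Eucl N → Prop} (h : ∀ᵐ x, P x) :
    ∀ᵐ z : Eucl N × Eucl N, P z.1 ∧ P z.2 :=
  ((Measure.quasiMeasurePreserving_fst (μ := (volume : Measure (Eucl N)))
    (ν := (volume : Measure (Eucl N)))).ae h).and
  ((Measure.quasiMeasurePreserving_snd (μ := (volume : Measure (Eucl N)))
    (ν := (volume : Measure (Eucl N)))).ae h)

theorem integrable_abs_rpow [hp : Fact (1 < p)] (u : SobolevSpace Ω s p) :
    Integrable (fun x => |u.toLp x| ^ p) := by
  have hp0 : 0 < p := by linarith [hp.out]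
  have h := (Lp.memLp u.toLp).integrable_norm_rpow (by simpa using hp0) ENNReal.ofReal_ne_top
  rw [ENNReal.toReal_ofReal hp0.le] at h
  exact h

/-- The approximating test functions vanish off `Ω`, hence so does their almost everywhere limit.
This turns sign information on `Ω` into sign information on the whole space. -/
theorem ae_eq_zero_of_notMem [hp : Fact (1 < p)] (u : SobolevSpace Ω s p) :
    ∀ᵐ x, x ∉ Ω → u.toLp x = 0 := by
  obtain ⟨-, φ, hφ, hφ1, -⟩ := (Subtype.prop u : u.toLp ∈ sobolevSubmodule Ω s p)
  have hq0 : ENNReal.ofReal p ≠ 0 := by simpa using zero_lt_one.trans hp.out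
  have hum := Lp.aestronglyMeasurable u.toLp
  obtain ⟨ns, -, hae⟩ := exists_subseq_tendsto_ae hq0
    (fun n => (hφ n).aestronglyMeasurable) (fun n => (hφ n).aestronglyMeasurable) hum hum
    hφ1 hφ1
  filter_upwards [hae] with x hx hxΩ
  refine tendsto_nhds_unique hx.1 (tendsto_const_nhds.congr fun n => ?_)
  by_contra hne
  exact hxΩ ((hφ _).2.2 (subset_tsupport _ (Ne.symm hne)))

end SobolevSpace

/-! ### Sublevel sets of the energy on the sphere -/

/-- The elements of `S_p(Ω)` of energy at most `M`. -/
def energySublevel [NeZero N] (Ω : Set (Eucl N)) (s p : ℝ) [Fact (1 < p)] (M : ℝ) :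
    Set (SobolevSpace Ω s p) :=
  {u | u ∈ unitLpSphere Ω s p ∧ ‖u‖ ^ p ≤ M}

theorem neg_mem_unitLpSphere [Fact (1 < p)] {u : SobolevSpace Ω s p}
    (hu : u ∈ unitLpSphere Ω s p) : -u ∈ unitLpSphere Ω s p := by
  refine Eq.trans (integral_congr_ae (ae_restrict_of_ae ?_)) hu
  filter_upwards [u.coeFn_neg] with x hx
  rw [hx, Pi.neg_apply, abs_neg]

theorem neg_mem_energySublevel [NeZero N] [Fact (1 < p)] {M : ℝ} {u : SobolevSpace Ω s p}
    (hu : u ∈ energySublevel Ω s p M) : -u ∈ energySublevel Ω s p M :=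
  ⟨neg_mem_unitLpSphere hu.1, by simpa using hu.2⟩

theorem JoinedIn.neg_energySublevel [NeZero N] [Fact (1 < p)] {M : ℝ} {u v : SobolevSpace Ω s p}
    (h : JoinedIn (energySublevel Ω s p M) u v) : JoinedIn (energySublevel Ω s p M) (-u) (-v) := by
  obtain ⟨γ, hγ⟩ := h
  exact ⟨γ.map continuous_neg, fun t => neg_mem_energySublevel (hγ t)⟩

theorem joinedIn_of_forall_mem_Icc {X : Type*} [TopologicalSpace X] {S : Set X}
    (w : C(unitInterval, X)) {a b : unitInterval} (hab : a ≤ b) (h : ∀ t ∈ Icc a b, w t ∈ S) :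
    JoinedIn S (w a) (w b) := by
  have hc : IsPathConnected (Icc (a : ℝ) b) :=
    (convex_Icc (a : ℝ) b).isPathConnected (nonempty_Icc.2 hab)
  have hi := hc.image (f := fun t => w (projIcc 0 1 zero_le_one t))
    (w.continuous.comp continuous_projIcc)
  have hmem : ∀ t : unitInterval, t ∈ Icc a b →
      w t ∈ (fun t : ℝ => w (projIcc 0 1 zero_le_one t)) '' Icc (a : ℝ) b := fun t ht =>
    ⟨t, ⟨ht.1, ht.2⟩, by simp⟩
  refine (hi.joinedIn _ (hmem a (left_mem_Icc.2 hab)) _ (hmem b (right_mem_Icc.2 hab))).mono ?_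
  rintro _ ⟨t, ht, rfl⟩
  have ht01 : t ∈ Icc (0 : ℝ) 1 := ⟨a.2.1.trans ht.1, ht.2.trans b.2.2⟩
  simp only [projIcc_of_mem zero_le_one ht01]
  exact h ⟨t, ht01⟩ ht

/-! ### Nonnegative elements of a sublevel set are joined in it -/

/-- Along the curve of `lpMean`s the integral of the `p`-th power is affine in `t`, hence constantly
`1`, and the energy lies below its chord. The signs ensure that the curve ends at `u` and `v` and
not at their absolute values. -/
theorem joinedIn_energySublevel_of_nonneg [NeZero N] [hp : Fact (1 < p)] {M : ℝ}
    {u v : SobolevSpace Ω s p} (hu : u ∈ energySublevel Ω s p M)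
    (hv : v ∈ energySublevel Ω s p M) (hu0 : ∀ᵐ x, 0 ≤ u.toLp x) (hv0 : ∀ᵐ x, 0 ≤ v.toLp x) :
    JoinedIn (energySublevel Ω s p M) u v := by
  have hp0 : 0 < p := by linarith [hp.out]
  obtain ⟨w, hw⟩ := SobolevSpace.exists_continuousMap_comp
    (G := fun (t : unitInterval) r => lpMean p t r.1 r.2) (K := 1)
    (fun t => lipschitzWith_lpMean hp.out t.2)
    (fun t => by simp [lpMean, Real.zero_rpow hp0.ne', hp0.ne'])
    (fun r => by
      have h : Continuous fun t : unitInterval =>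
          (1 - (t : ℝ)) * |r.1| ^ p + (t : ℝ) * |r.2| ^ p := by fun_prop
      exact h.rpow_const fun _ => Or.inr (by positivity)) u v
  have hw0 : w 0 = u := by
    refine SobolevSpace.ext_ae ?_
    filter_upwards [hw 0, hu0] with x hx hx0
    rw [hx]
    simp [lpMean, Real.rpow_rpow_inv hx0 hp0.ne', abs_of_nonneg hx0]
  have hw1 : w 1 = v := by
    refine SobolevSpace.ext_ae ?_
    filter_upwards [hw 1, hv0] with x hx hx0
    rw [hx]
    simp [lpMean, Real.rpow_rpow_inv hx0 hp0.ne', abs_of_nonneg hx0]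
  rw [← hw0, ← hw1]
  refine joinedIn_of_forall_mem_Icc w zero_le_one fun t _ => ⟨?_, ?_⟩
  · have h1 : ∫ x in Ω, |(w t).toLp x| ^ p =
        ∫ x in Ω, ((1 - (t : ℝ)) * |u.toLp x| ^ p + t * |v.toLp x| ^ p) := by
      refine integral_congr_ae (ae_restrict_of_ae ?_)
      filter_upwards [hw t] with x hx
      rw [hx, abs_of_nonneg (lpMean_nonneg p t.2 _ _), lpMean_rpow hp.out t.2]
    have h2 : ∫ x in Ω, |u.toLp x| ^ p = 1 := hu.1
    have h3 : ∫ x in Ω, |v.toLp x| ^ p = 1 := hv.1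
    change ∫ x in Ω, |(w t).toLp x| ^ p = 1
    rw [h1, integral_add (u.integrable_abs_rpow.integrableOn.const_mul _)
      (v.integrable_abs_rpow.integrableOn.const_mul _), integral_const_mul, integral_const_mul,
      h2, h3]
    ring
  · have h1 : ‖w t‖ ^ p ≤ (1 - (t : ℝ)) * ‖u‖ ^ p + t * ‖v‖ ^ p := by
      refine SobolevSpace.norm_rpow_le_of_ae_le ?_
      filter_upwards [SobolevSpace.ae_fst_snd_volume (hw t)] with z hz
      unfold energyDensity
      rw [hz.1, hz.2, ← mul_div_assoc, ← mul_div_assoc, ← add_div]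
      exact div_le_div_of_nonneg_right (abs_lpMean_sub_rpow_le hp.out t.2 _ _ _ _)
        (by positivity)
    have h2 := mul_le_mul_of_nonneg_left hu.2 (sub_nonneg.2 t.2.2)
    have h3 := mul_le_mul_of_nonneg_left hv.2 t.2.1
    linarith

/-! ### Joining an element to its positive or negative part -/

/-- `c^(1/p) r⁺ - d^(1/p) r⁻`. -/
def signSplit (p c d r : ℝ) : ℝ := c ^ (1 / p) * max r 0 - d ^ (1 / p) * max (-r) 0

/-- The two summands are both nondecreasing in `r`, so their increments have the same sign. This
equality, rather than an estimate, makes `concave_rpow_add_rpow` applicable. -/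
theorem abs_signSplit_sub {c d : ℝ} (p : ℝ) (hc : 0 ≤ c) (hd : 0 ≤ d) (r r' : ℝ) :
    |signSplit p c d r - signSplit p c d r'| =
      c ^ (1 / p) * |max r 0 - max r' 0| + d ^ (1 / p) * |max (-r) 0 - max (-r') 0| := by
  wlog h : r' ≤ r generalizing r r'
  · rw [abs_sub_comm, this r' r (le_of_not_ge h), abs_sub_comm (max r' 0),
      abs_sub_comm (max (-r') 0)]
  have h1 : 0 ≤ max r 0 - max r' 0 := sub_nonneg.2 (max_le_max_right 0 h)
  have h2 : max (-r) 0 - max (-r') 0 ≤ 0 := sub_nonpos.2 (max_le_max_right 0 (neg_le_neg h))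
  have hc' : 0 ≤ c ^ (1 / p) := Real.rpow_nonneg hc _
  have hd' : 0 ≤ d ^ (1 / p) := Real.rpow_nonneg hd _
  have h3 := mul_nonneg hc' h1
  have h4 := mul_nonneg hd' (neg_nonneg.2 h2)
  unfold signSplit
  rw [abs_of_nonneg h1, abs_of_nonpos h2, abs_of_nonneg (by linarith)]
  ring

theorem abs_signSplit_rpow {c d : ℝ} (hp : 1 < p) (hc : 0 ≤ c) (hd : 0 ≤ d) (r : ℝ) :
    |signSplit p c d r| ^ p = c * max r 0 ^ p + d * max (-r) 0 ^ p := by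
  have hp0 : p ≠ 0 := by linarith
  have key : ∀ {w x : ℝ}, 0 ≤ w → 0 ≤ x → (w ^ (1 / p) * x) ^ p = w * x ^ p := by
    intro w x hw hx
    rw [Real.mul_rpow (by positivity) hx, ← Real.rpow_mul hw, one_div_mul_cancel hp0,
      Real.rpow_one]
  unfold signSplit
  rcases le_total 0 r with h | h
  · rw [max_eq_left h, max_eq_right (neg_nonpos.2 h), mul_zero, sub_zero,
      abs_of_nonneg (by positivity), key hc h, Real.zero_rpow hp0, mul_zero, add_zero]
  · have h' := neg_nonneg.2 h
    rw [max_eq_right h, max_eq_left h', mul_zero, zero_sub, abs_neg,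
      abs_of_nonneg (by positivity), key hd h', Real.zero_rpow hp0, mul_zero, zero_add]

theorem lipschitzWith_signSplit {c d : ℝ} (p : ℝ) (hc : 0 ≤ c) (hd : 0 ≤ d) {K : NNReal}
    (hK : c ^ (1 / p) + d ^ (1 / p) ≤ K) :
    LipschitzWith K (fun r : ℝ × ℝ => signSplit p c d r.1) := by
  refine LipschitzWith.of_dist_le_mul fun x y => ?_
  have h0 : |x.1 - y.1| ≤ dist x y := le_max_left _ _
  have h1 : |max x.1 0 - max y.1 0| ≤ dist x y := (abs_max_sub_max_le_abs _ _ _).trans h0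
  have h2 : |max (-x.1) 0 - max (-y.1) 0| ≤ dist x y := by
    refine (abs_max_sub_max_le_abs _ _ _).trans ?_
    rwa [neg_sub_neg, abs_sub_comm]
  rw [Real.dist_eq, abs_signSplit_sub p hc hd]
  have h3 := mul_le_mul_of_nonneg_left h1 (Real.rpow_nonneg hc (1 / p))
  have h4 := mul_le_mul_of_nonneg_left h2 (Real.rpow_nonneg hd (1 / p))
  have h5 := mul_le_mul_of_nonneg_right hK (dist_nonneg (x := x) (y := y))
  linarith

/-- `∫_Ω (u⁺)^p`. -/
def posMass [Fact (1 < p)] (u : SobolevSpace Ω s p) : ℝ := ∫ x in Ω, max (u.toLp x) 0 ^ p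

/-- `∫_Ω (u⁻)^p`. -/
def negMass [Fact (1 < p)] (u : SobolevSpace Ω s p) : ℝ := ∫ x in Ω, max (-u.toLp x) 0 ^ p

theorem posMass_nonneg [Fact (1 < p)] (u : SobolevSpace Ω s p) : 0 ≤ posMass u :=
  integral_nonneg fun _ => Real.rpow_nonneg (le_max_right _ _) _

theorem negMass_nonneg [Fact (1 < p)] (u : SobolevSpace Ω s p) : 0 ≤ negMass u :=
  integral_nonneg fun _ => Real.rpow_nonneg (le_max_right _ _) _

theorem integrable_pos_rpow [hp : Fact (1 < p)] (u : SobolevSpace Ω s p) :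
    Integrable (fun x => max (u.toLp x) 0 ^ p) := by
  refine u.integrable_abs_rpow.mono' (((Lp.aestronglyMeasurable u.toLp).aemeasurable.max
    aemeasurable_const).pow_const p).aestronglyMeasurable (Eventually.of_forall fun x => ?_)
  have h : 0 ≤ max (u.toLp x) 0 := le_max_right _ _
  rw [Real.norm_of_nonneg (by positivity)]
  exact Real.rpow_le_rpow h (max_le (le_abs_self _) (abs_nonneg _)) (by linarith [hp.out])

theorem integrable_neg_rpow [hp : Fact (1 < p)] (u : SobolevSpace Ω s p) :
    Integrable (fun x => max (-u.toLp x) 0 ^ p) := by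
  refine u.integrable_abs_rpow.mono' (((Lp.aestronglyMeasurable u.toLp).aemeasurable.neg.max
    aemeasurable_const).pow_const p).aestronglyMeasurable (Eventually.of_forall fun x => ?_)
  have h : 0 ≤ max (-u.toLp x) 0 := le_max_right _ _
  rw [Real.norm_of_nonneg (by positivity)]
  exact Real.rpow_le_rpow h (max_le (neg_le_abs _) (abs_nonneg _)) (by linarith [hp.out])

theorem signSplit_one (p r : ℝ) : signSplit p 1 1 r = r := by
  simp only [signSplit, Real.one_rpow, one_mul]
  rcases le_total 0 r with h | h
  · rw [max_eq_left h, max_eq_right (neg_nonpos.2 h), sub_zero]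
  · rw [max_eq_right h, max_eq_left (neg_nonneg.2 h), zero_sub, neg_neg]

theorem posMass_add_negMass [hp : Fact (1 < p)] (u : SobolevSpace Ω s p) :
    posMass u + negMass u = ∫ x in Ω, |u.toLp x| ^ p := by
  rw [posMass, negMass, ← integral_add (integrable_pos_rpow u).integrableOn
    (integrable_neg_rpow u).integrableOn]
  refine integral_congr_ae (Eventually.of_forall fun x => ?_)
  have h := abs_signSplit_rpow hp.out zero_le_one zero_le_one (u.toLp x)
  rw [signSplit_one, one_mul, one_mul] at h
  exact h.symm

/-- The curve on the sphere from the normalized positive part to the normalized negative part. The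
energy along it is concave in a suitable parameter, and it runs through `u` if `u` is on the
sphere. -/
theorem exists_path_pos_neg [NeZero N] [hp : Fact (1 < p)] (u : SobolevSpace Ω s p)
    (ha : 0 < posMass u) (hb : 0 < negMass u) :
    ∃ w : C(unitInterval, SobolevSpace Ω s p), (∀ t, w t ∈ unitLpSphere Ω s p) ∧
      (∀ᵐ x, 0 ≤ (w 0).toLp x) ∧ (∀ᵐ x, (w 1).toLp x ≤ 0) ∧
      (u ∈ unitLpSphere Ω s p → ∃ t, w t = u) ∧
      ∀ t₁ t t₂, t₁ ≤ t → t ≤ t₂ → min (‖w t₁‖ ^ p) (‖w t₂‖ ^ p) ≤ ‖w t‖ ^ p := by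
  have hp0 : 0 < p := by linarith [hp.out]
  set a := posMass u with had
  set b := negMass u with hbd
  have hc : ∀ t : unitInterval, 0 ≤ (1 - (t : ℝ)) / a := fun t =>
    div_nonneg (sub_nonneg.2 t.2.2) ha.le
  have hd : ∀ t : unitInterval, 0 ≤ (t : ℝ) / b := fun t => div_nonneg t.2.1 hb.le
  have hK : ∀ t : unitInterval, ((1 - (t : ℝ)) / a) ^ (1 / p) + ((t : ℝ) / b) ^ (1 / p) ≤
      ((1 / a) ^ (1 / p) + (1 / b) ^ (1 / p)).toNNReal := by
    intro t
    refine le_trans (add_le_add ?_ ?_) (Real.le_coe_toNNReal _)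
    · refine Real.rpow_le_rpow (hc t) ?_ (by positivity)
      exact div_le_div_of_nonneg_right (by linarith [t.2.1]) ha.le
    · exact Real.rpow_le_rpow (hd t) (div_le_div_of_nonneg_right t.2.2 hb.le) (by positivity)
  -- The coefficients are affine in `t`, which carries concavity over to `t`, and satisfy `c * a + d
  -- * b = 1`, which keeps the curve on the sphere. Only the first variable of `G` matters.
  obtain ⟨w, hw⟩ := SobolevSpace.exists_continuousMap_comp
    (G := fun (t : unitInterval) r => signSplit p ((1 - (t : ℝ)) / a) (t / b) r.1)
    (fun t => lipschitzWith_signSplit p (hc t) (hd t) (hK t))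
    (fun t => by simp [signSplit])
    (fun r => by
      have h1 : Continuous fun t : unitInterval => (1 - (t : ℝ)) / a := by fun_prop
      have h2 : Continuous fun t : unitInterval => (t : ℝ) / b := by fun_prop
      have hp1 : 0 ≤ 1 / p := by positivity
      exact ((h1.rpow_const fun _ => Or.inr hp1).mul continuous_const).sub
        ((h2.rpow_const fun _ => Or.inr hp1).mul continuous_const)) u u
  refine ⟨w, fun t => ?_, ?_, ?_, fun hu => ?_, fun t₁ t t₂ h₁ h₂ => ?_⟩
  · have h1 : ∫ x in Ω, |(w t).toLp x| ^ p = ∫ x in Ω, ((1 - (t : ℝ)) / a *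
        max (u.toLp x) 0 ^ p + t / b * max (-u.toLp x) 0 ^ p) := by
      refine integral_congr_ae (ae_restrict_of_ae ?_)
      filter_upwards [hw t] with x hx
      rw [hx, abs_signSplit_rpow hp.out (hc t) (hd t)]
    change ∫ x in Ω, |(w t).toLp x| ^ p = 1
    rw [h1, integral_add ((integrable_pos_rpow u).integrableOn.const_mul _)
      ((integrable_neg_rpow u).integrableOn.const_mul _), integral_const_mul, integral_const_mul]
    change (1 - (t : ℝ)) / a * a + t / b * b = 1
    field_simp
    ring
  · filter_upwards [hw 0] with x hx
    rw [hx]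
    simp only [signSplit, Icc.coe_zero, sub_zero, zero_div]
    rw [Real.zero_rpow (by positivity), zero_mul, sub_zero]
    positivity
  · filter_upwards [hw 1] with x hx
    rw [hx]
    simp only [signSplit, Icc.coe_one, sub_self, zero_div]
    rw [Real.zero_rpow (by positivity), zero_mul, zero_sub, neg_nonpos]
    positivity
  · have hab : a + b = 1 := (posMass_add_negMass u).trans hu
    -- As `a + b = 1`, both coefficients equal `1` at `t = b`.
    refine ⟨⟨b, hb.le, by linarith⟩, SobolevSpace.ext_ae ?_⟩
    filter_upwards [hw ⟨b, hb.le, by linarith⟩] with x hx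
    rw [hx]
    rw [← hab, add_sub_cancel_right, div_self ha.ne', div_self hb.ne', signSplit_one]
  · obtain ⟨θ, hθ, hθt⟩ : ∃ θ ∈ Icc (0 : ℝ) 1, (1 - θ) * (t₁ : ℝ) + θ * t₂ = t := by
      have hseg : (t : ℝ) ∈ segment ℝ (t₁ : ℝ) t₂ := by
        rw [segment_eq_Icc (show (t₁ : ℝ) ≤ t₂ from h₁.trans h₂)]
        exact ⟨h₁, h₂⟩
      obtain ⟨x, y, hx, hy, hxy, h⟩ := hseg
      exact ⟨y, ⟨hy, by linarith⟩, by rw [← h, ← hxy]; simp⟩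
    have h1 : (1 - θ) * ‖w t₁‖ ^ p + θ * ‖w t₂‖ ^ p ≤ ‖w t‖ ^ p := by
      refine SobolevSpace.le_norm_rpow_of_ae_le ?_
      filter_upwards [SobolevSpace.ae_fst_snd_volume (hw t),
        SobolevSpace.ae_fst_snd_volume (hw t₁), SobolevSpace.ae_fst_snd_volume (hw t₂)]
        with z hz hz1 hz2
      unfold energyDensity
      rw [hz.1, hz.2, hz1.1, hz1.2, hz2.1, hz2.2, ← mul_div_assoc, ← mul_div_assoc, ← add_div]
      refine div_le_div_of_nonneg_right ?_ (by positivity)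
      rw [abs_signSplit_sub p (hc _) (hd _), abs_signSplit_sub p (hc _) (hd _),
        abs_signSplit_sub p (hc _) (hd _)]
      have h2 := concave_rpow_add_rpow hp.out hθ (hc t₁) (hd t₁) (hc t₂) (hd t₂)
        (abs_nonneg (max (u.toLp z.1) 0 - max (u.toLp z.2) 0))
        (abs_nonneg (max (-u.toLp z.1) 0 - max (-u.toLp z.2) 0))
      have h3 : (1 - θ) * ((1 - (t₁ : ℝ)) / a) + θ * ((1 - (t₂ : ℝ)) / a) = (1 - (t : ℝ)) / a := by
        rw [← hθt]
        ring
      have h4 : (1 - θ) * ((t₁ : ℝ) / b) + θ * ((t₂ : ℝ) / b) = t / b := by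
        rw [← hθt]
        ring
      rwa [h3, h4] at h2
    have h5 := mul_le_mul_of_nonneg_left (min_le_left (‖w t₁‖ ^ p) (‖w t₂‖ ^ p))
      (sub_nonneg.2 hθ.2)
    have h6 := mul_le_mul_of_nonneg_left (min_le_right (‖w t₁‖ ^ p) (‖w t₂‖ ^ p)) hθ.1
    linarith

theorem exists_joinedIn_signed [NeZero N] [hp : Fact (1 < p)] (hΩ : MeasurableSet Ω) {M : ℝ}
    {u : SobolevSpace Ω s p} (hu : u ∈ energySublevel Ω s p M) :
    ∃ v, JoinedIn (energySublevel Ω s p M) u v ∧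
      ((∀ᵐ x, 0 ≤ v.toLp x) ∨ ∀ᵐ x, v.toLp x ≤ 0) := by
  have hp0 : 0 < p := by linarith [hp.out]
  have key : ∀ {f : Eucl N → ℝ}, (∫ x in Ω, max (f x) 0 ^ p) = 0 →
      Integrable (fun x => max (f x) 0 ^ p) → (∀ᵐ x, x ∉ Ω → f x = 0) → ∀ᵐ x, f x ≤ 0 := by
    intro f h1 h2 h3
    rw [integral_eq_zero_iff_of_nonneg (fun x => Real.rpow_nonneg (le_max_right _ _) _)
      h2.integrableOn] at h1
    filter_upwards [(ae_restrict_iff' hΩ).1 h1, h3] with x hx hx'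
    by_cases hxΩ : x ∈ Ω
    · have h4 := (Real.rpow_eq_zero (le_max_right _ _) hp0.ne').1 (hx hxΩ)
      exact (le_max_left _ _).trans h4.le
    · exact (hx' hxΩ).le
  rcases (posMass_nonneg u).eq_or_lt with ha | ha
  · exact ⟨u, JoinedIn.refl hu, Or.inr (key ha.symm (integrable_pos_rpow u)
      u.ae_eq_zero_of_notMem)⟩
  rcases (negMass_nonneg u).eq_or_lt with hb | hb
  · refine ⟨u, JoinedIn.refl hu, Or.inl ?_⟩
    have h := key hb.symm (integrable_neg_rpow u) (by
      filter_upwards [u.ae_eq_zero_of_notMem] with x hx hxΩ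
      rw [hx hxΩ, neg_zero])
    filter_upwards [h] with x hx using neg_nonpos.1 hx
  obtain ⟨w, hwS, hw0, hw1, hwu, hmin⟩ := exists_path_pos_neg u ha hb
  obtain ⟨τ, rfl⟩ := hwu hu.1
  -- If the energy exceeded `M` somewhere on each side of `τ`, the lower bound by the minimum would
  -- make it exceed `M` at `τ` too. So one of the two arcs stays in the sublevel set.
  by_cases hl : ∀ t ∈ Icc 0 τ, ‖w t‖ ^ p ≤ M
  · exact ⟨w 0, (joinedIn_of_forall_mem_Icc (S := energySublevel Ω s p M) w τ.2.1
      fun t ht => ⟨hwS t, hl t ht⟩).symm, Or.inl hw0⟩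
  · push Not at hl
    obtain ⟨t₁, ht₁, hM₁⟩ := hl
    refine ⟨w 1, joinedIn_of_forall_mem_Icc w τ.2.2 fun t ht => ⟨hwS t, ?_⟩, Or.inr hw1⟩
    by_contra! hM₂
    exact absurd ((hmin t₁ τ t ht₁.2 ht.1).trans hu.2) (not_le.2 (lt_min hM₁ hM₂))

/-- If some element of a sublevel set is joined in it to its opposite, then so is every element. -/
theorem joinedIn_neg_of_joinedIn_neg [NeZero N] [hp : Fact (1 < p)] (hΩ : MeasurableSet Ω) {M : ℝ}
    {u v : SobolevSpace Ω s p} (hu : u ∈ energySublevel Ω s p M)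
    (hv : JoinedIn (energySublevel Ω s p M) v (-v)) :
    JoinedIn (energySublevel Ω s p M) u (-u) := by
  obtain ⟨x, hux, hx⟩ := exists_joinedIn_signed hΩ hu
  obtain ⟨y, hvy, hy⟩ := exists_joinedIn_signed hΩ hv.source_mem
  have hneg : ∀ {z : SobolevSpace Ω s p}, (∀ᵐ x, z.toLp x ≤ 0) → ∀ᵐ x, 0 ≤ (-z).toLp x := by
    intro z hz
    filter_upwards [z.coeFn_neg, hz] with x h1 h2
    rw [h1]
    exact neg_nonneg.2 h2
  have hxS := hux.target_mem
  have hyS := hvy.target_mem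
  have hyy : JoinedIn (energySublevel Ω s p M) y (-y) :=
    (hvy.symm.trans hv).trans (JoinedIn.neg_energySublevel hvy)
  -- Equal signs are joined directly, after a change of sign if both are nonpositive; opposite signs
  -- go through `-y`.
  have hxy : JoinedIn (energySublevel Ω s p M) x y := by
    rcases hx with hx | hx <;> rcases hy with hy | hy
    · exact joinedIn_energySublevel_of_nonneg hxS hyS hx hy
    · exact (joinedIn_energySublevel_of_nonneg hxS (neg_mem_energySublevel hyS) hx
        (hneg hy)).trans hyy.symm
    · have h := JoinedIn.neg_energySublevel (joinedIn_energySublevel_of_nonneg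
        (neg_mem_energySublevel hxS) hyS (hneg hx) hy)
      rw [neg_neg] at h
      exact h.trans hyy.symm
    · have h := JoinedIn.neg_energySublevel (joinedIn_energySublevel_of_nonneg
        (neg_mem_energySublevel hxS) (neg_mem_energySublevel hyS) (hneg hx) (hneg hy))
      rwa [neg_neg, neg_neg] at h
  have huy := hux.trans hxy
  exact (huy.trans hyy).trans (JoinedIn.neg_energySublevel huy.symm)

/-! ### A sign-changing element -/

theorem IsTestFunction.exists_sobolevSpace [hp : Fact (1 < p)] {φ : Eucl N → ℝ}
    (hφ : IsTestFunction Ω φ) (hfin : gagliardoSeminorm s p φ < ∞) :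
    ∃ u : SobolevSpace Ω s p, ⇑u.toLp =ᵐ[volume] φ := by
  have hLp : MemLp φ (ENNReal.ofReal p) volume := hφ.1.continuous.memLp_of_hasCompactSupport hφ.2.1
  have hco := hLp.coeFn_toLp
  have hsub : (⇑(hLp.toLp φ) - φ : Eucl N → ℝ) =ᵐ[volume] 0 := by
    filter_upwards [hco] with x hx
    simp [hx]
  have h0 : gagliardoSeminorm s p (0 : Eucl N → ℝ) = 0 := by
    simpa using gagliardoSeminorm_smul s hp.out 0 (0 : Eucl N → ℝ)
  refine ⟨(⟨hLp.toLp φ, ?_, fun _ => φ, fun _ => hφ, ?_, ?_⟩ : ↥(sobolevSubmodule Ω s p)), hco⟩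
  · rwa [gagliardoSeminorm_congr s hco]
  · simp [eLpNorm_congr_ae hsub]
  · simp [gagliardoSeminorm_congr s hsub, h0]

theorem integral_pos_part_rpow_pos {g : Eucl N → ℝ}
    (hg : Continuous g) (hgΩ : ∀ x ∉ Ω, g x = 0)
    (hint : IntegrableOn (fun x => max (g x) 0 ^ p) Ω) {x₀ : Eucl N} (hx₀ : 0 < g x₀) :
    0 < ∫ x in Ω, max (g x) 0 ^ p := by
  rw [setIntegral_pos_iff_support_of_nonneg_ae
    (Eventually.of_forall fun x => Real.rpow_nonneg (le_max_right _ _) _) hint]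
  refine ((isOpen_lt continuous_const hg).measure_pos volume ⟨x₀, hx₀⟩).trans_le
    (measure_mono fun x (hx : 0 < g x) => ⟨?_, ?_⟩)
  · rw [Function.mem_support, max_eq_left hx.le]
    positivity
  · by_contra hn
    exact hx.ne' (hgΩ x hn)

/-- A test function close to `u` in both norms is nonzero and inherits a finite seminorm from `u`. A
Lipschitz function of it then takes both signs. -/
theorem exists_posMass_negMass_pos [NeZero N] [hp : Fact (1 < p)]
    {u : SobolevSpace Ω s p} (hu : u ∈ unitLpSphere Ω s p) :
    ∃ v : SobolevSpace Ω s p, 0 < posMass v ∧ 0 < negMass v := by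
  have hp0 : 0 < p := by linarith [hp.out]
  have hum := Lp.aestronglyMeasurable u.toLp
  obtain ⟨hufin, φ', hφ', hφ1, hφ2⟩ := (Subtype.prop u : u.toLp ∈ sobolevSubmodule Ω s p)
  have hu0 : 0 < eLpNorm u.toLp (ENNReal.ofReal p) volume := by
    rw [pos_iff_ne_zero, Ne, eLpNorm_eq_zero_iff hum (by simpa using hp0)]
    intro h
    have h1 : ∫ x in Ω, |u.toLp x| ^ p = ∫ x in Ω, (0 : ℝ) := by
      refine integral_congr_ae (ae_restrict_of_ae ?_)
      filter_upwards [h] with x hx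
      simp [hx, Real.zero_rpow hp0.ne']
    have h2 : ∫ x in Ω, |u.toLp x| ^ p = 1 := hu
    simp [h2] at h1
  obtain ⟨n, hn1, hn2⟩ := ((hφ1.eventually_lt_const hu0).and
    (hφ2.eventually_lt_const ENNReal.zero_lt_top)).exists
  obtain ⟨φ, hφd⟩ : ∃ φ, φ = φ' n := ⟨_, rfl⟩
  have hφ := hφ' n
  rw [← hφd] at hn1 hn2 hφ
  obtain ⟨x₀, hx₀⟩ : ∃ x, φ x ≠ 0 := by
    by_contra! h
    have h0 : φ = 0 := funext h
    rw [h0, sub_zero] at hn1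
    exact lt_irrefl _ hn1
  have hφfin : gagliardoSeminorm s p φ < ∞ := by
    have h1 : φ = ⇑u.toLp + (-1 : ℝ) • (⇑u.toLp - φ) := by
      ext x
      simp
    have h2 := hum.sub hφ.aestronglyMeasurable
    rw [h1]
    refine (gagliardoSeminorm_add_le s hp.out hum (h2.const_smul _)).trans_lt ?_
    rw [gagliardoSeminorm_smul s hp.out]
    exact ENNReal.add_lt_top.2 ⟨hufin, ENNReal.mul_lt_top enorm_lt_top hn2⟩
  obtain ⟨U, hU⟩ := hφ.exists_sobolevSpace hφfin
  set m : ℝ := |φ x₀| with hm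
  have hm0 : 0 < m := abs_pos.2 hx₀
  obtain ⟨x₁, hx₁⟩ : ∃ x, |φ x| = m / 4 := by
    have : NoncompactSpace (Eucl N) := NormedSpace.noncompactSpace ℝ (Eucl N)
    obtain ⟨y, hy⟩ : ∃ y, φ y = 0 := by
      by_contra! h
      have h1 : tsupport φ = univ := by
        rw [tsupport, eq_univ_of_forall (s := Function.support φ) h, closure_univ]
      exact noncompact_univ (Eucl N) (h1 ▸ hφ.2.1)
    exact mem_range_of_exists_le_of_exists_ge hφ.1.continuous.abs
      ⟨y, by rw [hy, abs_zero]; linarith⟩ ⟨x₀, by linarith⟩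
  -- This function of `φ` vanishes where `φ` does, equals `m / 4 > 0` at `x₁` and `-m / 2 < 0` at
  -- `x₀`.
  have hG : LipschitzWith 1 (fun r : ℝ × ℝ => min |r.1| (m / 2 - |r.1|)) := by
    refine LipschitzWith.of_dist_le_mul fun x y => ?_
    rw [NNReal.coe_one, one_mul, Real.dist_eq]
    have h1 : |x.1 - y.1| ≤ dist x y := le_max_left _ _
    refine (abs_min_sub_min_le_max _ _ _ _).trans (max_le ?_ ?_)
    · exact (abs_abs_sub_abs_le_abs_sub _ _).trans h1
    · rw [sub_sub_sub_cancel_left, abs_sub_comm]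
      exact (abs_abs_sub_abs_le_abs_sub _ _).trans h1
  obtain ⟨v, hv⟩ := SobolevSpace.exists_comp hG (by simp [(half_pos hm0).le]) U U
  set g : Eucl N → ℝ := fun x => min |φ x| (m / 2 - |φ x|) with hgd
  have hvg : ⇑v.toLp =ᵐ[volume] g := by
    filter_upwards [hv, hU] with x hx hx'
    rw [hx, hx']
  have hgc : Continuous g := hφ.1.continuous.abs.min (continuous_const.sub hφ.1.continuous.abs)
  have hgΩ : ∀ x ∉ Ω, g x = 0 := by
    intro x hx
    have h1 : φ x = 0 := by
      by_contra h
      exact hx (hφ.2.2 (subset_tsupport _ h))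
    simp [hgd, h1, (half_pos hm0).le]
  have hpos : (fun x => max (v.toLp x) 0 ^ p) =ᵐ[volume] fun x => max (g x) 0 ^ p := by
    filter_upwards [hvg] with x hx
    rw [hx]
  have hneg : (fun x => max (-v.toLp x) 0 ^ p) =ᵐ[volume] fun x => max (-g x) 0 ^ p := by
    filter_upwards [hvg] with x hx
    rw [hx]
  refine ⟨v, ?_, ?_⟩
  · rw [posMass, integral_congr_ae (ae_restrict_of_ae hpos)]
    refine integral_pos_part_rpow_pos hgc hgΩ
      ((integrable_pos_rpow v).congr hpos).integrableOn (x₀ := x₁) (lt_min ?_ ?_) <;>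
      rw [hx₁] <;> linarith
  · rw [negMass, integral_congr_ae (ae_restrict_of_ae hneg)]
    refine integral_pos_part_rpow_pos hgc.neg (fun x hx => by simp [hgΩ x hx])
      ((integrable_neg_rpow v).congr hneg).integrableOn (x₀ := x₀) (neg_pos.2 ?_)
    refine (min_le_right _ _).trans_lt ?_
    linarith

/-! ### Paths and odd maps -/

theorem exists_path_of_joinedIn [NeZero N] [Fact (1 < p)] {M : ℝ} {u v : SobolevSpace Ω s p}
    (h : JoinedIn (energySublevel Ω s p M) u v) :
    ∃ γ ∈ pathsOnSphere u v, ∃ M' ≤ M, IsMaxEnergy γ M' := by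
  obtain ⟨γ, hγ⟩ := h
  obtain ⟨M', hM'⟩ := exists_isMaxEnergy γ.toContinuousMap
  refine ⟨γ.toContinuousMap, ⟨fun t => (hγ t).1, γ.source, γ.target⟩, M', ?_, hM'⟩
  obtain ⟨_, ⟨t, rfl⟩, h⟩ := hM'.1
  rw [← h]
  exact (hγ t).2

theorem exists_path_neg [NeZero N] [hp : Fact (1 < p)] (hΩ : MeasurableSet Ω)
    {u : SobolevSpace Ω s p} (hu : u ∈ unitLpSphere Ω s p) :
    ∃ γ ∈ pathsOnSphere u (-u), ∃ M, IsMaxEnergy γ M := by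
  obtain ⟨v, ha, hb⟩ := exists_posMass_negMass_pos hu
  obtain ⟨w, hwS, hw0, hw1, -, -⟩ := exists_path_pos_neg v ha hb
  obtain ⟨M₀, hM₀⟩ := exists_isMaxEnergy w
  -- A level high enough to contain both the curve `w` and `u`; there `w 1` reaches `-w 1` through
  -- the nonnegative `w 0`.
  set M := max M₀ (‖u‖ ^ p) with hM
  have hw : ∀ t, w t ∈ energySublevel Ω s p M := fun t =>
    ⟨hwS t, (hM₀.2 ⟨w t, ⟨t, rfl⟩, rfl⟩).trans (le_max_left _ _)⟩
  have h1 : JoinedIn (energySublevel Ω s p M) (w 1) (w 0) :=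
    (joinedIn_of_forall_mem_Icc w zero_le_one fun t _ => hw t).symm
  have h2 : JoinedIn (energySublevel Ω s p M) (w 0) (-w 1) := by
    refine joinedIn_energySublevel_of_nonneg (hw 0) (neg_mem_energySublevel (hw 1)) hw0 ?_
    filter_upwards [(w 1).coeFn_neg, hw1] with x h1 h2
    rw [h1]
    exact neg_nonneg.2 h2
  obtain ⟨γ, hγ, M', -, hM'⟩ := exists_path_of_joinedIn
    (joinedIn_neg_of_joinedIn_neg hΩ ⟨hu, le_max_right _ _⟩ (h1.trans h2))
  exact ⟨γ, hγ, M', hM'⟩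

theorem pathConnectedSpace_unitCircle : PathConnectedSpace UnitCircle := by
  refine isPathConnected_iff_pathConnectedSpace.1 (isPathConnected_sphere ?_ _ zero_le_one)
  exact Module.lt_rank_of_lt_finrank (by simp)

theorem exists_path_of_oddMap [NeZero N] [hp : Fact (1 < p)] (hΩ : MeasurableSet Ω)
    {u : SobolevSpace Ω s p} (hu : IsFirstEigenfunction u)
    {f : C(UnitCircle, SobolevSpace Ω s p)} (hf : f ∈ oddMaps Ω s p) {M : ℝ}
    (hM : IsMaxEnergy f M) :
    ∃ γ ∈ pathsOnSphere u (-u), ∃ M' ≤ M, IsMaxEnergy γ M' := by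
  have hfM : ∀ ω, f ω ∈ energySublevel Ω s p M := fun ω =>
    ⟨hf.1 ω, hM.2 ⟨f ω, ⟨ω, rfl⟩, rfl⟩⟩
  have := pathConnectedSpace_unitCircle
  obtain ⟨ω⟩ := this.nonempty
  have h1 : JoinedIn (energySublevel Ω s p M) (f ω) (-f ω) := by
    rw [← hf.2 ω]
    exact ⟨(PathConnectedSpace.somePath ω (-ω)).map f.continuous, fun t => hfM _⟩
  exact exists_path_of_joinedIn (joinedIn_neg_of_joinedIn_neg hΩ
    ⟨hu.1, (hu.2 (hf.1 ω)).trans (hfM ω).2⟩ h1)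

/-- The odd map on the circle that runs along `γ` on the upper half circle. -/
theorem exists_oddMap_of_path [NeZero N] [hp : Fact (1 < p)] {u : SobolevSpace Ω s p}
    {γ : C(unitInterval, SobolevSpace Ω s p)} (hγ : γ ∈ pathsOnSphere u (-u)) {M : ℝ}
    (hM : IsMaxEnergy γ M) : ∃ f ∈ oddMaps Ω s p, ∃ M' ≤ M, IsMaxEnergy f M' := by
  have hγM : ∀ t, γ t ∈ energySublevel Ω s p M := fun t =>
    ⟨hγ.1 t, hM.2 ⟨γ t, ⟨t, rfl⟩, rfl⟩⟩
  -- `(1 - ω₀) / 2` runs from `0` at `(1, 0)` to `1` at `(-1, 0)`. On the lower half circle `-A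
  -- (-ω)` is used; the two formulas agree at these two points because `γ 1 = -γ 0`.
  set A : UnitCircle → SobolevSpace Ω s p := fun ω =>
    γ (projIcc 0 1 zero_le_one ((1 - ω.1 0) / 2)) with hA
  have hAc : Continuous A := by
    refine γ.continuous.comp (continuous_projIcc.comp ?_)
    fun_prop
  have hA0 : ∀ ω : UnitCircle, ω.1 1 = 0 → A ω = -A (-ω) := by
    intro ω hω
    have h1 : ω.1 0 ^ 2 = 1 := by
      have h := ω.2
      rw [mem_sphere_zero_iff_norm, EuclideanSpace.norm_eq, Real.sqrt_eq_one] at h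
      simpa [Fin.sum_univ_two, hω] using h
    have hn : (-ω).1 0 = -ω.1 0 := rfl
    simp only [hA, hn]
    rcases eq_or_eq_neg_of_sq_eq_sq (ω.1 0) 1 (by rw [h1, one_pow]) with h | h
    · rw [h, show ((1 : ℝ) - 1) / 2 = 0 by norm_num, show ((1 : ℝ) - -1) / 2 = 1 by norm_num,
        projIcc_left, projIcc_right]
      change γ 0 = -γ 1
      rw [hγ.2.1, hγ.2.2, neg_neg]
    · rw [h, show ((1 : ℝ) - - -1) / 2 = 0 by norm_num, show ((1 : ℝ) - -1) / 2 = 1 by norm_num,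
        projIcc_left, projIcc_right]
      change γ 1 = -γ 0
      rw [hγ.2.1, hγ.2.2]
  have hfc : Continuous fun ω : UnitCircle => if 0 ≤ ω.1 1 then A ω else -A (-ω) := by
    refine Continuous.if_le hAc (hAc.comp continuous_neg).neg continuous_const (by fun_prop) ?_
    exact fun ω hω => hA0 ω hω.symm
  have hfM : ∀ ω : UnitCircle,
      (if 0 ≤ ω.1 1 then A ω else -A (-ω)) ∈ energySublevel Ω s p M := by
    intro ω
    split_ifs
    · exact hγM _
    · exact neg_mem_energySublevel (hγM _)
  have := pathConnectedSpace_unitCircle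
  let f : C(UnitCircle, SobolevSpace Ω s p) := ⟨_, hfc⟩
  obtain ⟨M', hM'⟩ := exists_isMaxEnergy f
  refine ⟨f, ⟨fun ω => (hfM ω).1, fun ω => ?_⟩, M', ?_, hM'⟩
  · change (if 0 ≤ (-ω).1 1 then A (-ω) else -A (- -ω)) = -if 0 ≤ ω.1 1 then A ω else -A (-ω)
    have hn : (-ω).1 1 = -ω.1 1 := rfl
    rw [hn, neg_neg]
    rcases lt_trichotomy (ω.1 1) 0 with h | h | h
    · rw [if_pos (by linarith), if_neg (by linarith), neg_neg]
    · rw [if_pos (by linarith), if_pos (by linarith), hA0 ω h, neg_neg]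
    · rw [if_neg (by linarith), if_pos h.le]
  · obtain ⟨_, ⟨ω, rfl⟩, h⟩ := hM'.1
    rw [← h]
    exact (hfM ω).2

end FracPLaplace

end

/-- `IsGLB` in `ℝ` also contains the nonemptiness of the set of paths, since the empty set has no
greatest lower bound there. -/
theorem mainTheorem3 {N : ℕ} [NeZero N] {s p : ℝ} [Fact (1 < p)] (hs0 : 0 < s) (hs1 : s < 1)
    {Ω : Set (FracPLaplace.Eucl N)} (hΩ : IsOpen Ω) (hΩb : Bornology.IsBounded Ω)
    (u₁ : FracPLaplace.SobolevSpace Ω s p) (hu₁ : FracPLaplace.IsFirstEigenfunction u₁) :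
    IsGLB {M : ℝ | ∃ γ ∈ FracPLaplace.pathsOnSphere u₁ (-u₁), FracPLaplace.IsMaxEnergy γ M}
      (FracPLaplace.secondEigenvalue Ω s p) := by
  have hbdd : BddBelow {M | ∃ f ∈ FracPLaplace.oddMaps Ω s p, FracPLaplace.IsMaxEnergy f M} := by
    refine ⟨0, ?_⟩
    rintro M ⟨f, -, hM⟩
    obtain ⟨u, -, h⟩ := hM.1
    rw [← h]
    positivity
  constructor
  · rintro M ⟨γ, hγ, hM⟩
    obtain ⟨f, hf, M', hM'M, hM'⟩ := FracPLaplace.exists_oddMap_of_path hγ hM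
    exact (csInf_le hbdd ⟨f, hf, hM'⟩).trans hM'M
  · intro c hc
    -- Some path, hence some odd map, must exist: otherwise `secondEigenvalue` would be `sInf ∅`,
    -- which is `0` by convention.
    obtain ⟨γ, hγ, M, hM⟩ := FracPLaplace.exists_path_neg hΩ.measurableSet hu₁.1
    obtain ⟨f, hf, M', -, hM'⟩ := FracPLaplace.exists_oddMap_of_path hγ hM
    refine le_csInf ⟨M', f, hf, hM'⟩ ?_
    rintro R ⟨g, hg, hR⟩
    obtain ⟨γ', hγ', R', hR'R, hR'⟩ :=
      FracPLaplace.exists_path_of_oddMap hΩ.measurableSet hu₁ hg hR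
    exact (hc ⟨γ', hγ', hR'⟩).trans hR'R
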